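/- **Proposition 1 (Taylor expansion of the energy distance).** Let $d>1$. For random vectors $X,Y$ in $\mathbb{R}^d$ with finite third absolute moments, and independent copies $X',Y'$ (with $X,X',Y,Y'$ independent), let $$\mathcal{D}^2(X,Y):=\mathbb{E}\|X-Y\|-\tfrac12\mathbb{E}\|X-X'\|-\tfrac12\mathbb{E}\|Y-Y'\|,$$ let $\bar X=\mathbb{E}X$, $\bar Y=\mathbb{E}Y$, and $$\mu_i=\bar X_i-\bar Y_i,\qquad \Delta_{ij}=\mathrm{Cov}(X_i,X_j)-\mathrm{Cov}(Y_i,Y_j),$$ $$\kappa_{ijk}=\mathbb{E}[(X_i-\bar X_i)(X_j-\bar X_j)(X_k-\bar X_k)]-\mathbb{E}[(Y_i-\bar Y_i)(Y_j-\bar Y_j)(Y_k-\bar Y_k)],\qquad \beta\cdot\mu:=\sum_{i,j=1}^d\kappa_{iij}\mu_j .$$ Let $d\Omega$ be the surface measure on the unit sphere $\mathbb{S}^{d-1}\subset\mathbb{R}^d$, let $c_d:=\mathrm{Vol}(\mathbb{S}^d)$, and $\|f\|_{C^5_r}:=\sup_{\|\omega\|\le r}\sum_{|\alpha|\le5}|\partial^\alpha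 f(\omega)|$. Fix $H:\mathbb{R}^d\to\mathbb{R}$, $B:\mathbb{R}\to\mathbb{R}$, $b\in(0,1)$ and $K\in\mathbb{R}$. There is a constant $C>0$ such that the following holds for every $\lambda>0$ and all $X,Y$ as above (which may depend on $\lambda$). Suppose that there are functions $U,V$ with $\mathbb{E}e^{i\omega\cdot X}=e^{U(\omega)}$ and $\mathbb{E}e^{i\omega\cdot Y}=e^{V(\omega)}$ for all $\omega$, and that with $W:=U-V$: - $\left|\exp\{(U(\omega)+V(\omega))/2\}\right|^2=H(\lambda\omega)$ for all $\omega\in\mathbb{R}^d$; - $e^{W}$ and $e^{-W}$ are of class $C^5$ and $\|e^{W}\|_{C^5_r}+\|e^{-W}\|_{C^5_r}\le B(r)$ for all $r\ge0$; - $\omega\mapsto \frac{H(\lambda\omega)}{\|\omega\|^{d+1}}\|\omega\|^5B(\|\omega\|)$ is integrable on $\mathbb{R}^d$, with integral at most $K\lambda^{-(4-b)}$. Then $$\mathcal{D}^2(X,Y)=\frac1\lambda\frac1{c_d}\int_0^\infty\!\int_{\mathbb{S}^{d-1}}H(r\theta)(\theta\cdot\mu)^2\,d\Omega(\theta)\,dr$$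 $$+\frac1{\lambda^3}\frac1{12c_d}\int_0^\infty r^2\!\int_{\mathbb{S}^{d-1}}H(r\theta)\Big[3(\theta\cdot\Delta\theta)^2-(\theta\cdot\mu)^4-4(\theta\cdot\mu)\sum_{i,j,k=1}^d\kappa_{ijk}\theta_i\theta_j\theta_k\Big]d\Omega(\theta)\,dr+R(\lambda),$$ where the integrals over $r$ converge absolutely and $|R(\lambda)|\le C\lambda^{-(4-b)}$. If moreover $H(\omega)=h(\|\omega\|)$ for all $\omega$, then $h$ and $r^2h$ are integrable on $(0,\infty)$ and $$\mathcal{D}^2(X,Y)=\frac1\lambda\frac{\mathrm{Vol}(\mathbb{S}^{d-1})}{c_d\,d}\|\mu\|^2\int_0^\infty h(r)\,dr+\frac1{\lambda^3}\frac{\mathrm{Vol}(\mathbb{S}^{d-1})}{4c_d\,d(d+2)}\Big[2\|\Delta\|_F^2+\mathrm{Trace}(\Delta)^2-\|\mu\|^4-4\beta\cdot\mu\Big]\int_0^\infty h(r)r^2\,dr+R(\lambda),$$ again with $|R(\lambda)|\le C\lambda^{-(4-b)}$. Finally, if a random vector $X$ with finite third absolute moments is symmetric about its mean, then $\mathbb{E}[(X_i-\bar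 X_i)^2(X_j-\bar X_j)]=0$ for all $i,j$. -/

import Mathlib

open MeasureTheory
open scoped ENNReal

noncomputable section

/-- `d`-dimensional Euclidean space. -/
abbrev Euc (d : ℕ) : Type := EuclideanSpace ℝ (Fin d)

/-- The squared energy distance `E‖X - Y‖ - E‖X - X'‖ / 2 - E‖Y - Y'‖ / 2` between the laws `P` of
`X, X'` and `Q` of `Y, Y'`, where `X, X', Y, Y'` are independent. -/
def energyDistSq {d : ℕ} (P Q : Measure (Euc d)) : ℝ :=
  (∫ z, ‖z.1 - z.2‖ ∂(P.prod Q)) - (1 / 2) * (∫ z, ‖z.1 - z.2‖ ∂(P.prod P))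
    - (1 / 2) * (∫ z, ‖z.1 - z.2‖ ∂(Q.prod Q))

/-- The surface measure on the unit sphere of `ℝ ^ d`. -/
def surfaceMeasure (d : ℕ) : Measure (Metric.sphere (0 : Euc d) 1) :=
  (volume : Measure (Euc d)).toSphere

/-- The surface area of the unit sphere of `ℝ ^ d`, a sphere of dimension `d - 1`. -/
def sphereArea (d : ℕ) : ℝ := (surfaceMeasure d).real Set.univ

/-- The constant `c_d`, the surface area of the `d`-dimensional unit sphere of `ℝ ^ (d + 1)`. -/
def energyConst (d : ℕ) : ℝ := sphereArea (d + 1)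

/-- The `i`-th coordinate of the mean of a law. -/
def mean {d : ℕ} (P : Measure (Euc d)) (i : Fin d) : ℝ := ∫ x, x i ∂P

/-- The covariance of the coordinates `i` and `j` under a law. -/
def cov {d : ℕ} (P : Measure (Euc d)) (i j : Fin d) : ℝ :=
  ∫ x, (x i - mean P i) * (x j - mean P j) ∂P

/-- The third central moment of the coordinates `i`, `j` and `k` under a law. -/
def centralMoment₃ {d : ℕ} (P : Measure (Euc d)) (i j k : Fin d) : ℝ :=
  ∫ x, (x i - mean P i) * (x j - mean P j) * (x k - mean P k) ∂P

/-- The difference of the means. -/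
def meanDiff {d : ℕ} (P Q : Measure (Euc d)) (i : Fin d) : ℝ := mean P i - mean Q i

/-- The difference of the covariance matrices. -/
def covDiff {d : ℕ} (P Q : Measure (Euc d)) : Matrix (Fin d) (Fin d) ℝ :=
  Matrix.of fun i j => cov P i j - cov Q i j

/-- The difference of the third central moments. -/
def skewDiff {d : ℕ} (P Q : Measure (Euc d)) (i j k : Fin d) : ℝ :=
  centralMoment₃ P i j k - centralMoment₃ Q i j k

/-- The linear form `x · μ`. -/
def meanForm {d : ℕ} (P Q : Measure (Euc d)) (x : Euc d) : ℝ := ∑ i, x i * meanDiff P Q i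

/-- The quadratic form `x · Δ x`. -/
def covForm {d : ℕ} (P Q : Measure (Euc d)) (x : Euc d) : ℝ :=
  ∑ i, ∑ j, x i * covDiff P Q i j * x j

/-- The cubic form `∑ κ_{ijk} x_i x_j x_k`. -/
def skewForm {d : ℕ} (P Q : Measure (Euc d)) (x : Euc d) : ℝ :=
  ∑ i, ∑ j, ∑ k, skewDiff P Q i j k * x i * x j * x k

/-- The squared Euclidean norm `‖μ‖²` of the difference of the means. -/
def meanDiffSq {d : ℕ} (P Q : Measure (Euc d)) : ℝ := ∑ i, meanDiff P Q i ^ 2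

/-- The squared Frobenius norm of the difference of the covariance matrices. -/
def covDiffFrobSq {d : ℕ} (P Q : Measure (Euc d)) : ℝ := ∑ i, ∑ j, covDiff P Q i j ^ 2

/-- The number `β · μ = ∑ κ_{iij} μ_j`. -/
def skewMean {d : ℕ} (P Q : Measure (Euc d)) : ℝ :=
  ∑ i, ∑ j, skewDiff P Q i i j * meanDiff P Q j

/-- The list of coordinate directions that contains each `i` exactly `α i` times. -/
def multiIndexDirs {d : ℕ} (α : Fin d → ℕ) : List (Fin d) :=
  (List.finRange d).flatMap fun i => List.replicate (α i) i

/-- The partial derivative `∂^α f` of multi-index `α`, for a function `f` that is smooth enough: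
the derivative of order `|α|`, applied to standard basis vectors, each `e_i` taken `α i` times. -/
def multiDeriv {d : ℕ} (α : Fin d → ℕ) (f : Euc d → ℂ) (ω : Euc d) : ℂ :=
  iteratedFDeriv ℝ (multiIndexDirs α).length f ω
    fun n => EuclideanSpace.single ((multiIndexDirs α).get n) (1 : ℝ)

/-- The norm `sup_{‖ω‖ ≤ r} ∑_{|α| ≤ 5} |∂^α f(ω)|`. -/
def normC5 {d : ℕ} (r : ℝ) (f : Euc d → ℂ) : ℝ≥0∞ :=
  ⨆ ω ∈ Metric.closedBall (0 : Euc d) r,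
    ∑ k ∈ Finset.range 6, ∑ α ∈ Finset.piAntidiag (Finset.univ : Finset (Fin d)) k,
      ‖multiDeriv α f ω‖ₑ

/-- The spherical integrand of the term of order `1 / lam`, at radius `r`. -/
def firstSpherical {d : ℕ} (H : Euc d → ℝ) (P Q : Measure (Euc d)) (r : ℝ) : ℝ :=
  ∫ θ, H (r • (θ : Euc d)) * meanForm P Q θ ^ 2 ∂(surfaceMeasure d)

/-- The spherical integrand of the term of order `1 / lam ^ 3`, at radius `r`. -/
def secondSpherical {d : ℕ} (H : Euc d → ℝ) (P Q : Measure (Euc d)) (r : ℝ) : ℝ :=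
  ∫ θ, H (r • (θ : Euc d)) *
    (3 * covForm P Q θ ^ 2 - meanForm P Q θ ^ 4 - 4 * meanForm P Q θ * skewForm P Q θ)
      ∂(surfaceMeasure d)

/-- The two hypotheses that tie `X ∼ P`, `Y ∼ Q` and `lam` to the fixed data `H`, `B`, `b`, `K`:
the characteristic functions are `e^U` and `e^V`, with `|e^{(U+V)/2}|² = H(lam ω)`, and the `C⁵`
bounds on `e^{±(U-V)}` by `B` hold, where `B` grows slowly in comparison with the decay of `H`. -/
structure LeadingMomentAssumptions {d : ℕ} (H : Euc d → ℝ) (B : ℝ → ℝ) (b K lam : ℝ)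
    (P Q : Measure (Euc d)) (U V : Euc d → ℂ) : Prop where
  charFun_left : ∀ ω, charFun P ω = Complex.exp (U ω)
  charFun_right : ∀ ω, charFun Q ω = Complex.exp (V ω)
  decay : ∀ ω, ‖Complex.exp ((U ω + V ω) / 2)‖ ^ 2 = H (lam • ω)
  contDiff_pos : ContDiff ℝ 5 fun ω => Complex.exp (U ω - V ω)
  contDiff_neg : ContDiff ℝ 5 fun ω => Complex.exp (-(U ω - V ω))
  bound : ∀ r : ℝ, 0 ≤ r →
    normC5 r (fun ω => Complex.exp (U ω - V ω)) + normC5 r (fun ω => Complex.exp (-(U ω - V ω)))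
      ≤ ENNReal.ofReal (B r)
  growth_integrable :
    Integrable fun ω : Euc d => H (lam • ω) / ‖ω‖ ^ (d + 1) * ‖ω‖ ^ 5 * B ‖ω‖
  growth : ∫ ω : Euc d, H (lam • ω) / ‖ω‖ ^ (d + 1) * ‖ω‖ ^ 5 * B ‖ω‖ ≤ K * lam ^ (-(4 - b))

end

/-! The starting point is the identity `∫ (1 - cos⟨ω, x⟩) / ‖ω‖ ^ (d + 1) dω = (c_d / 2) ‖x‖`.
Taking expectations with `x = X - Y`, `X - X'`, `Y - Y'` turns the energy distance into `(1 / c_d) ∫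
|φ_P - φ_Q|² / ‖ω‖ ^ (d + 1)` (`energyDistSq_eq`).

With `F = e^W = e^(U - V)` one has `|e^U - e^V|² = |e^((U + V) / 2)|² |F - 1|² / |F| = H(lam ω) |2
sinh(W / 2)|²`. Along a ray `ω = tθ`, `W` is a difference of cumulant generating functions, `i μ t -
Δ t² / 2 - i κ t³ / 6 + O(t⁴)`, where `μ, Δ, κ` are the forms evaluated at `θ`. Hence `|2 sinh(W /
2)|² = μ² t² + (3Δ² - μ⁴ - 4μκ) t⁴ / 12 + O(t⁵)` (`exists_bound_norm_sub_one_sq_div`). The proof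
never differentiates `U` or `V`: the derivatives of `F` at the origin come from `F φ_Q = φ_P` and
the Leibniz rule (`iteratedDeriv_quotient_line`).

The error is at most a constant times `H(lam ω) ‖ω‖⁵ B(‖ω‖)` for every `ω ≠ 0`
(`exists_remainder_bound`): for `‖ω‖ ≤ 1` by Taylor's formula, for `‖ω‖ ≥ 1` because `|F - 1|² / |F|
≤ |F| + 2 + 1 / |F|` is controlled by `B`. The constant depends only on `d` and `B 1`, since `B 1`
bounds the derivatives of `F` near the origin and therefore also `μ`, `Δ` and `κ`. The growth
hypothesis then integrates the error to order `lam ^ (-(4 - b))`.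

The two main terms are homogeneous of degrees 2 and 4, so polar coordinates and the scaling `r ↦ lam
r` produce the factors `1 / lam` and `1 / lam ^ 3`
(`LeadingMomentAssumptions.integral_homogeneous`). For radial `H` the remaining spherical integrals
are second and fourth moments of the sphere, read off from Gaussian moments. -/

/-! ### Polar coordinates and Gaussian moments. -/

theorem finrank_euc (d : ℕ) : Module.finrank ℝ (Euc d) = d := by simp

theorem nontrivial_euc {d : ℕ} (hd : 1 < d) : Nontrivial (Euc d) := by
  have : Nonempty (Fin d) := ⟨⟨0, by omega⟩⟩
  infer_instance

instance (d : ℕ) : IsFiniteMeasure (surfaceMeasure d) := by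
  unfold surfaceMeasure; infer_instance

/-- Integration in polar coordinates. -/
theorem integral_polar {d : ℕ} {f : Euc d → ℝ} (hd : 1 < d) (hf : Integrable f) :
    IntegrableOn (fun r : ℝ => r ^ (d - 1) * ∫ θ, f (r • (θ : Euc d)) ∂(surfaceMeasure d))
      (Set.Ioi 0) ∧
    ∫ x, f x = ∫ r in Set.Ioi (0 : ℝ), r ^ (d - 1) *
      ∫ θ, f (r • (θ : Euc d)) ∂(surfaceMeasure d) := by
  have := nontrivial_euc hd
  have hmp := (volume : Measure (Euc d)).measurePreserving_homeomorphUnitSphereProd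
  have hemb := (homeomorphUnitSphereProd (Euc d)).measurableEmbedding
  rw [finrank_euc] at hmp
  let g : Metric.sphere (0 : Euc d) 1 × Set.Ioi (0 : ℝ) → ℝ := fun p => f (p.2.1 • p.1.1)
  have hg : g ∘ homeomorphUnitSphereProd (Euc d) = fun x : ({0}ᶜ : Set (Euc d)) => f x := by
    ext x
    have hx : ‖x.1‖ ≠ 0 := norm_ne_zero_iff.2 x.2
    simp [g, smul_smul, hx]
  have hint : Integrable g ((surfaceMeasure d).prod (Measure.volumeIoiPow (d - 1))) := by
    have := (hmp.integrable_comp_emb hemb (g := g)).1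
    refine this ?_
    rw [hg]
    refine (integrableOn_iff_comap_subtypeVal (measurableSet_singleton _).compl).1 ?_
    exact hf.integrableOn
  have heq : ∫ x, f x = ∫ p, g p ∂((surfaceMeasure d).prod (Measure.volumeIoiPow (d - 1))) := by
    rw [surfaceMeasure, ← hmp.integral_comp hemb g]
    change _ = ∫ x, (g ∘ homeomorphUnitSphereProd (Euc d)) x ∂_
    rw [hg, integral_subtype_comap (measurableSet_singleton _).compl fun x => f x,
      restrict_compl_singleton]
  constructor
  · have h1 := hint.integral_prod_right
    rw [Measure.volumeIoiPow, integrable_withDensity_iff_integrable_smul' (by fun_prop)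
      (by simp)] at h1
    refine (integrableOn_iff_comap_subtypeVal measurableSet_Ioi).2 ?_
    refine h1.congr (.of_forall fun r => ?_)
    have hr : (0 : ℝ) < r := r.2
    simp only [g, smul_eq_mul, Function.comp_apply]
    rw [ENNReal.toReal_ofReal (by positivity)]
  · rw [heq, integral_prod_symm _ hint]
    simp only [Measure.volumeIoiPow, ENNReal.ofReal]
    rw [integral_withDensity_eq_integral_smul, integral_subtype_comap measurableSet_Ioi
      fun a : ℝ => Real.toNNReal (a ^ (d - 1)) • ∫ θ, f (a • (θ : Euc d)) ∂(surfaceMeasure d)]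
    · refine setIntegral_congr_fun measurableSet_Ioi fun r hr => ?_
      simp only [NNReal.smul_def]
      rw [Real.coe_toNNReal _ (pow_nonneg (le_of_lt hr) _), smul_eq_mul]
    · exact (measurable_subtype_coe.pow_const _).real_toNNReal

/-- Polynomials are integrable against the Gaussian weight. -/
theorem integrable_mul_gaussian {d : ℕ} (hd : 1 < d) {p : Euc d → ℝ} (hp : Continuous p) (k : ℕ)
    {C : ℝ} (hC : ∀ x, |p x| ≤ C * ‖x‖ ^ k) :
    Integrable fun x : Euc d => p x * Real.exp (-(1 / 2) * ‖x‖ ^ 2) := by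
  have := nontrivial_euc hd
  have h1 : Integrable fun x : Euc d => C * (‖x‖ ^ k * Real.exp (-(1 / 2) * ‖x‖ ^ 2)) := by
    refine Integrable.const_mul ?_ _
    refine (integrable_fun_norm_addHaar (volume : Measure (Euc d))
      (f := fun r => r ^ k * Real.exp (-(1 / 2) * r ^ 2))).2 ?_
    rw [finrank_euc]
    have := integrableOn_rpow_mul_exp_neg_mul_sq (b := 1 / 2) (by norm_num)
      (s := ((d - 1 + k : ℕ) : ℝ)) (by
        have : (0 : ℝ) ≤ ((d - 1 + k : ℕ) : ℝ) := by positivity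
        linarith)
    refine this.congr_fun (fun r _ => ?_) measurableSet_Ioi
    simp only [Real.rpow_natCast, smul_eq_mul]
    ring
  refine h1.mono' (by fun_prop) (.of_forall fun x => ?_)
  rw [Real.norm_eq_abs, abs_mul, abs_of_pos (Real.exp_pos _), ← mul_assoc]
  gcongr
  exact hC x

/-- The Gaussian integral of a homogeneous function, in terms of its spherical integral. -/
theorem integral_homogeneous_mul_gaussian {d : ℕ} (hd : 1 < d) {p : Euc d → ℝ} {k : ℕ}
    (hint : Integrable fun x : Euc d => p x * Real.exp (-(1 / 2) * ‖x‖ ^ 2))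
    (hom : ∀ (r : ℝ) x, p (r • x) = r ^ k * p x) :
    ∫ x : Euc d, p x * Real.exp (-(1 / 2) * ‖x‖ ^ 2) =
      (∫ r in Set.Ioi (0 : ℝ), r ^ (d - 1 + k) * Real.exp (-(1 / 2) * r ^ 2)) *
        ∫ θ, p θ ∂(surfaceMeasure d) := by
  rw [(integral_polar hd hint).2, ← integral_mul_const]
  refine setIntegral_congr_fun measurableSet_Ioi fun r hr => ?_
  have : ∀ θ : Metric.sphere (0 : Euc d) 1, p (r • (θ : Euc d)) *
      Real.exp (-(1 / 2) * ‖r • (θ : Euc d)‖ ^ 2) =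
      r ^ k * Real.exp (-(1 / 2) * r ^ 2) * p θ := fun θ => by
    rw [hom, norm_smul, norm_eq_of_mem_sphere θ, mul_one, Real.norm_eq_abs, sq_abs]; ring
  simp only [this]
  rw [integral_const_mul]; ring

/-- Stein's identity for the Gaussian weight. -/
theorem gaussian_stein {d : ℕ} {q : Euc d → ℝ} (hq : Differentiable ℝ q) (i : Fin d)
    (h0 : Integrable fun x : Euc d => q x * Real.exp (-(1 / 2) * ‖x‖ ^ 2))
    (h1 : Integrable fun x : Euc d => x i * q x * Real.exp (-(1 / 2) * ‖x‖ ^ 2))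
    (h2 : Integrable fun x : Euc d => fderiv ℝ q x (EuclideanSpace.single i 1) *
      Real.exp (-(1 / 2) * ‖x‖ ^ 2)) :
    ∫ x : Euc d, x i * q x * Real.exp (-(1 / 2) * ‖x‖ ^ 2) =
      ∫ x : Euc d, fderiv ℝ q x (EuclideanSpace.single i 1) *
        Real.exp (-(1 / 2) * ‖x‖ ^ 2) := by
  have hder : ∀ x : Euc d, HasFDerivAt (fun x : Euc d => Real.exp (-(1 / 2) * ‖x‖ ^ 2))
      (Real.exp (-(1 / 2) * ‖x‖ ^ 2) • (-(1 / 2) : ℝ) • (2 : ℝ) • innerSL ℝ x) x := fun x => by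
    have := ((hasStrictFDerivAt_norm_sq x).hasFDerivAt.const_mul (-(1 / 2) : ℝ)).exp
    rwa [← ofNat_smul_eq_nsmul ℝ 2] at this
  have hval : ∀ x : Euc d, fderiv ℝ (fun x : Euc d => Real.exp (-(1 / 2) * ‖x‖ ^ 2)) x
      (EuclideanSpace.single i 1) = -(x i * Real.exp (-(1 / 2) * ‖x‖ ^ 2)) := fun x => by
    rw [(hder x).fderiv]
    simp [EuclideanSpace.inner_single_right]
    ring
  have := integral_mul_fderiv_eq_neg_fderiv_mul_of_integrable (μ := (volume : Measure (Euc d)))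
    (f := q) (g := fun x : Euc d => Real.exp (-(1 / 2) * ‖x‖ ^ 2))
    (v := EuclideanSpace.single i 1) h2 (by
      simp only [hval]
      refine h1.neg.congr (.of_forall fun x => ?_)
      simp only [Pi.neg_apply]; ring) h0 (fun x _ => hq x) (fun x _ => (hder x).differentiableAt)
  simp only [hval] at this
  rw [← neg_inj, ← this, ← integral_neg]
  congr 1; ext x; ring

theorem abs_coord_le {d : ℕ} (x : Euc d) (i : Fin d) : |x i| ≤ ‖x‖ := by
  simpa using PiLp.norm_apply_le x i

theorem hasFDerivAt_coord {d : ℕ} (i : Fin d) (x : Euc d) :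
    HasFDerivAt (fun x : Euc d => x i) (EuclideanSpace.proj i : Euc d →L[ℝ] ℝ) x :=
  (EuclideanSpace.proj i : Euc d →L[ℝ] ℝ).hasFDerivAt

theorem integrable_gaussian_coord {d : ℕ} (hd : 1 < d) :
    Integrable (fun x : Euc d => Real.exp (-(1 / 2) * ‖x‖ ^ 2)) ∧
    (∀ i, Integrable fun x : Euc d => x i * Real.exp (-(1 / 2) * ‖x‖ ^ 2)) ∧
    (∀ i j, Integrable fun x : Euc d => x i * x j * Real.exp (-(1 / 2) * ‖x‖ ^ 2)) ∧
    (∀ i j k, Integrable fun x : Euc d => x i * x j * x k * Real.exp (-(1 / 2) * ‖x‖ ^ 2)) ∧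
    ∀ i j k l, Integrable fun x : Euc d =>
      x i * (x j * x k * x l) * Real.exp (-(1 / 2) * ‖x‖ ^ 2) := by
  refine ⟨?_, fun i => ?_, fun i j => ?_, fun i j k => ?_, fun i j k l => ?_⟩
  · simpa using integrable_mul_gaussian hd (p := fun _ => 1) (by fun_prop) 0 (C := 1) (by simp)
  · exact integrable_mul_gaussian hd (by fun_prop) 1 (C := 1) fun x => by
      simpa using abs_coord_le x i
  · exact integrable_mul_gaussian hd (by fun_prop) 2 (C := 1) fun x => by
      rw [abs_mul, one_mul, pow_two]
      gcongr <;> apply abs_coord_le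
  · exact integrable_mul_gaussian hd (by fun_prop) 3 (C := 1) fun x => by
      rw [abs_mul, abs_mul, one_mul, pow_succ, pow_two]
      gcongr <;> apply abs_coord_le
  · exact integrable_mul_gaussian hd (by fun_prop) 4 (C := 1) fun x => by
      rw [abs_mul, abs_mul, abs_mul, one_mul, pow_succ', pow_succ, pow_two]
      gcongr <;> apply abs_coord_le

theorem gaussian_second_moment {d : ℕ} (hd : 1 < d) (i j : Fin d) :
    ∫ x : Euc d, x i * x j * Real.exp (-(1 / 2) * ‖x‖ ^ 2) =
      (if i = j then 1 else 0) * ∫ x : Euc d, Real.exp (-(1 / 2) * ‖x‖ ^ 2) := by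
  obtain ⟨g0, g1, g2, g3, g4⟩ := integrable_gaussian_coord hd
  have hf : ∀ x : Euc d, fderiv ℝ (fun x : Euc d => x j) x (EuclideanSpace.single i 1) =
      if i = j then 1 else 0 := fun x => by
    rw [(hasFDerivAt_coord j x).fderiv]
    simp [eq_comm]
  rw [gaussian_stein (q := fun x => x j) (fun x => (hasFDerivAt_coord j x).differentiableAt) i
    (g1 j) (g2 i j) (by simp only [hf]; exact g0.const_mul _)]
  simp only [hf]
  rw [integral_const_mul]

/-- By Stein's identity, the factor `x i` differentiates the other three in turn; each derivative
leaves a second moment, which gives the three pairings of the indices. -/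
theorem gaussian_fourth_moment {d : ℕ} (hd : 1 < d) (i j k l : Fin d) :
    ∫ x : Euc d, x i * (x j * x k * x l) * Real.exp (-(1 / 2) * ‖x‖ ^ 2) =
      ((if i = j then 1 else 0) * (if k = l then 1 else 0) +
        (if i = k then 1 else 0) * (if j = l then 1 else 0) +
        (if i = l then 1 else 0) * (if j = k then 1 else 0)) *
        ∫ x : Euc d, Real.exp (-(1 / 2) * ‖x‖ ^ 2) := by
  obtain ⟨g0, g1, g2, g3, g4⟩ := integrable_gaussian_coord hd
  have hf : ∀ x : Euc d, fderiv ℝ (fun x : Euc d => x j * x k * x l) x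
      (EuclideanSpace.single i 1) * Real.exp (-(1 / 2) * ‖x‖ ^ 2) =
      (if i = j then 1 else 0) * (x k * x l * Real.exp (-(1 / 2) * ‖x‖ ^ 2)) +
      (if i = k then 1 else 0) * (x j * x l * Real.exp (-(1 / 2) * ‖x‖ ^ 2)) +
      (if i = l then 1 else 0) * (x j * x k * Real.exp (-(1 / 2) * ‖x‖ ^ 2)) := fun x => by
    have := ((hasFDerivAt_coord j x).mul (hasFDerivAt_coord k x)).mul (hasFDerivAt_coord l x)
    rw [HasFDerivAt.fderiv (f := fun x : Euc d => x j * x k * x l) this]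
    simp only [Pi.mul_apply, add_apply, smul_apply, PiLp.proj_apply,
      PiLp.single_apply, smul_eq_mul, eq_comm (a := i)]
    ring
  have hi := (((g2 k l).const_mul (if i = j then 1 else 0)).add
    ((g2 j l).const_mul (if i = k then 1 else 0)))
  have hi' := hi.add ((g2 j k).const_mul (if i = l then 1 else 0))
  rw [gaussian_stein (q := fun x => x j * x k * x l) (by fun_prop) i (g3 j k l) (g4 i j k l)
    (by simp only [hf]; exact hi')]
  simp only [hf]
  rw [integral_add (f := fun x : Euc d => _ + _) hi ((g2 j k).const_mul _), integral_add ((g2 k l).const_mul _)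
    ((g2 j l).const_mul _)]
  simp only [integral_const_mul, gaussian_second_moment hd]
  ring

/-! ### Second and fourth moments of the sphere. -/

theorem sphereArea_pos {d : ℕ} (hd : 1 < d) : 0 < sphereArea d := by
  have := nontrivial_euc hd
  rw [sphereArea, surfaceMeasure, Measure.toSphere_real_apply_univ, finrank_euc]
  have : 0 < (volume : Measure (Euc d)).real (Metric.ball 0 1) :=
    ENNReal.toReal_pos (Metric.measure_ball_pos _ _ one_pos).ne' measure_ball_lt_top.ne
  have : 0 < d := by omega
  positivity

theorem sphere_sum_sq {d : ℕ} (θ : Metric.sphere (0 : Euc d) 1) :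
    ∑ i, (θ : Euc d) i * (θ : Euc d) i = 1 := by
  have h := EuclideanSpace.real_norm_sq_eq (θ : Euc d)
  rw [norm_eq_of_mem_sphere] at h
  simpa [pow_two] using h.symm

theorem integrable_sphere {d : ℕ} {p : Euc d → ℝ} (hp : Continuous p) :
    Integrable (fun θ : Metric.sphere (0 : Euc d) 1 => p θ) (surfaceMeasure d) :=
  (hp.comp continuous_subtype_val).integrable_of_hasCompactSupport
    (HasCompactSupport.of_compactSpace _)

/-- In polar coordinates the Gaussian moment is a radial factor `J` times the spherical moment. `J`
need not be computed: taking the trace, where `∑ θ_i² = 1`, gives `J * sphereArea d = d * G`. -/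
theorem sphere_second_moment {d : ℕ} (hd : 1 < d) (i j : Fin d) :
    ∫ θ, (θ : Euc d) i * (θ : Euc d) j ∂(surfaceMeasure d) =
      (if i = j then 1 else 0) * (sphereArea d / d) := by
  obtain ⟨g0, g1, g2, g3, g4⟩ := integrable_gaussian_coord hd
  set G := ∫ x : Euc d, Real.exp (-(1 / 2) * ‖x‖ ^ 2) with hG
  set J := ∫ r in Set.Ioi (0 : ℝ), r ^ (d - 1 + 2) * Real.exp (-(1 / 2) * r ^ 2)
  have hGpos : 0 < G := integral_exp_pos g0
  have hd' : (d : ℝ) ≠ 0 := by positivity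
  have key : ∀ i j : Fin d, J * ∫ θ, (θ : Euc d) i * (θ : Euc d) j ∂(surfaceMeasure d) =
      (if i = j then 1 else 0) * G := fun i j => by
    rw [← gaussian_second_moment hd, integral_homogeneous_mul_gaussian hd
      (p := fun x => x i * x j) (k := 2) (g2 i j) (fun r x => by simp; ring)]
  have htr : J * sphereArea d = d * G := by
    have h1 : sphereArea d =
        ∑ i, ∫ θ, (θ : Euc d) i * (θ : Euc d) i ∂(surfaceMeasure d) := by
      rw [← integral_finsetSum _ fun i _ => integrable_sphere (p := fun x => x i * x i)
        (by fun_prop)]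
      simp [sphere_sum_sq, sphereArea]
    rw [h1, Finset.mul_sum]
    simp [key]
  have hJ : J ≠ 0 := by
    rintro h
    rw [h, zero_mul] at htr
    exact (mul_ne_zero hd' hGpos.ne') htr.symm
  apply mul_left_cancel₀ hJ
  rw [key, mul_left_comm, mul_div_assoc', htr]
  field_simp

theorem sphere_fourth_moment {d : ℕ} (hd : 1 < d) (i j k l : Fin d) :
    ∫ θ, (θ : Euc d) i * ((θ : Euc d) j * (θ : Euc d) k * (θ : Euc d) l) ∂(surfaceMeasure d) =
      ((if i = j then 1 else 0) * (if k = l then 1 else 0) +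
        (if i = k then 1 else 0) * (if j = l then 1 else 0) +
        (if i = l then 1 else 0) * (if j = k then 1 else 0)) *
        (sphereArea d / (d * (d + 2))) := by
  obtain ⟨g0, g1, g2, g3, g4⟩ := integrable_gaussian_coord hd
  set G := ∫ x : Euc d, Real.exp (-(1 / 2) * ‖x‖ ^ 2) with hG
  set J := ∫ r in Set.Ioi (0 : ℝ), r ^ (d - 1 + 4) * Real.exp (-(1 / 2) * r ^ 2)
  have hGpos : 0 < G := integral_exp_pos g0
  have hd' : (d : ℝ) ≠ 0 := by positivity
  have key : ∀ i j k l : Fin d, J * ∫ θ, (θ : Euc d) i *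
      ((θ : Euc d) j * (θ : Euc d) k * (θ : Euc d) l) ∂(surfaceMeasure d) =
      ((if i = j then 1 else 0) * (if k = l then 1 else 0) +
        (if i = k then 1 else 0) * (if j = l then 1 else 0) +
        (if i = l then 1 else 0) * (if j = k then 1 else 0)) * G := fun i j k l => by
    rw [← gaussian_fourth_moment hd, integral_homogeneous_mul_gaussian hd
      (p := fun x => x i * (x j * x k * x l)) (k := 4) (g4 i j k l) (fun r x => by simp; ring)]
  -- The double trace uses `∑ θ_i² θ_k² = 1`; the three pairings contribute `d²`, `d` and `d`.
  have htr : J * sphereArea d = d * (d + 2) * G := by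
    have h1 : sphereArea d = ∑ i, ∑ k, ∫ θ, (θ : Euc d) i *
        ((θ : Euc d) i * (θ : Euc d) k * (θ : Euc d) k) ∂(surfaceMeasure d) := by
      have hc : ∀ i k : Fin d, Integrable (fun θ : Metric.sphere (0 : Euc d) 1 => (θ : Euc d) i *
        ((θ : Euc d) i * (θ : Euc d) k * (θ : Euc d) k)) (surfaceMeasure d) := fun i k =>
          integrable_sphere (p := fun x => x i * (x i * x k * x k)) (by fun_prop)
      simp_rw [← integral_finsetSum _ fun k _ => hc _ k]
      rw [← integral_finsetSum _ fun i _ => integrable_finsetSum _ fun k _ => hc i k]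
      have : ∀ θ : Metric.sphere (0 : Euc d) 1, ∑ i, ∑ k, (θ : Euc d) i *
        ((θ : Euc d) i * (θ : Euc d) k * (θ : Euc d) k) = 1 := fun θ => by
          have h := congrArg₂ (· * ·) (sphere_sum_sq θ) (sphere_sum_sq θ)
          simp only [Finset.sum_mul_sum, mul_one] at h
          refine Eq.trans ?_ h
          refine Finset.sum_congr rfl fun i _ => Finset.sum_congr rfl fun k _ => by ring
      simp [this, sphereArea]
    rw [h1, Finset.mul_sum]
    simp_rw [Finset.mul_sum, key, ← Finset.sum_mul]
    congr 1
    simp [Finset.sum_add_distrib]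
    ring
  have hJ : J ≠ 0 := by
    rintro h
    rw [h, zero_mul] at htr
    exact (mul_ne_zero (by positivity) hGpos.ne') htr.symm
  apply mul_left_cancel₀ hJ
  rw [key, mul_left_comm, mul_div_assoc', htr]
  field_simp

/-! ### The integral of `(1 - cos⟨ω, x⟩) / ‖ω‖ ^ (d + 1)`. -/

-- Integration by parts: `-(1 - exp(-a v²)) / v` vanishes at both ends, and its derivative is the
-- integrand minus `2 a exp(-a v²)`, so a Gaussian integral remains.
open Filter Topology in
theorem integral_one_sub_exp_neg_mul_sq_div_sq {a : ℝ} (ha : 0 < a) :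
    IntegrableOn (fun v : ℝ => v ^ (-2 : ℝ) * (1 - Real.exp (-a * v ^ 2))) (Set.Ioi 0) ∧
    ∫ v in Set.Ioi (0 : ℝ), v ^ (-2 : ℝ) * (1 - Real.exp (-a * v ^ 2)) =
      √(Real.pi * a) := by
  have hexp : ∀ v : ℝ, 0 ≤ 1 - Real.exp (-a * v ^ 2) ∧ 1 - Real.exp (-a * v ^ 2) ≤ 1 ∧
      1 - Real.exp (-a * v ^ 2) ≤ a * v ^ 2 := fun v => by
    refine ⟨?_, ?_, ?_⟩
    · have : Real.exp (-a * v ^ 2) ≤ 1 := Real.exp_le_one_iff.2 (by nlinarith [sq_nonneg v])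
      linarith
    · linarith [Real.exp_pos (-a * v ^ 2)]
    · linarith [Real.add_one_le_exp (-a * v ^ 2)]
  have hint : IntegrableOn (fun v : ℝ => v ^ (-2 : ℝ) * (1 - Real.exp (-a * v ^ 2)))
      (Set.Ioi 0) := by
    rw [← Set.Ioc_union_Ioi_eq_Ioi (zero_le_one' ℝ)]
    refine IntegrableOn.union ?_ ?_
    · refine Measure.integrableOn_of_bounded (M := a) (by simp)
        (by fun_prop (disch := simp)) ?_
      filter_upwards [ae_restrict_mem measurableSet_Ioc] with v hv
      have hv0 : 0 < v := hv.1
      rw [Real.norm_of_nonneg (mul_nonneg (by positivity) (hexp v).1), Real.rpow_neg hv0.le,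
        Real.rpow_two, inv_mul_le_iff₀ (by positivity)]
      linarith [(hexp v).2.2]
    · refine (integrableOn_Ioi_rpow_of_lt (a := -2) (by norm_num) one_pos).mono'
        (by fun_prop (disch := simp)) ?_
      filter_upwards [ae_restrict_mem measurableSet_Ioi] with v hv
      have hv0 : (0 : ℝ) < v := one_pos.trans hv
      rw [Real.norm_of_nonneg (mul_nonneg (by positivity) (hexp v).1)]
      exact mul_le_of_le_one_right (by positivity) (hexp v).2.1
  refine ⟨hint, ?_⟩
  have hg : IntegrableOn (fun v : ℝ => 2 * a * Real.exp (-a * v ^ 2)) (Set.Ioi 0) :=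
    ((integrable_exp_neg_mul_sq ha).const_mul _).integrableOn
  have hderiv : ∀ v ∈ Set.Ioi (0 : ℝ), HasDerivAt (fun v : ℝ => -(v⁻¹ * (1 - Real.exp (-a * v ^ 2))))
      (v ^ (-2 : ℝ) * (1 - Real.exp (-a * v ^ 2)) - 2 * a * Real.exp (-a * v ^ 2)) v := by
    intro v hv
    have hv0 : (0 : ℝ) < v := hv
    have h1 := (hasDerivAt_inv hv0.ne')
    have h2 := (((hasDerivAt_pow 2 v).const_mul (-a)).exp).const_sub 1
    refine (h1.mul h2).neg.congr_deriv ?_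
    rw [Real.rpow_neg hv0.le, Real.rpow_two]
    simp
    field_simp
    ring
  have hzero : Tendsto (fun v : ℝ => -(v⁻¹ * (1 - Real.exp (-a * v ^ 2)))) (𝓝[>] 0) (𝓝 0) := by
    refine squeeze_zero_norm' (a := fun v => a * v) ?_ ?_
    · filter_upwards [self_mem_nhdsWithin] with v hv
      have hv0 : (0 : ℝ) < v := hv
      rw [norm_neg, Real.norm_of_nonneg (mul_nonneg (by positivity) (hexp v).1),
        inv_mul_le_iff₀ hv0]
      linarith [(hexp v).2.2]
    · have : Tendsto (fun v : ℝ => a * v) (𝓝 0) (𝓝 (a * 0)) := by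
        exact (continuous_const.mul continuous_id).tendsto 0
      rw [mul_zero] at this
      exact this.mono_left nhdsWithin_le_nhds
  have hinf : Tendsto (fun v : ℝ => -(v⁻¹ * (1 - Real.exp (-a * v ^ 2)))) atTop (𝓝 0) := by
    refine squeeze_zero_norm' (a := fun v => v⁻¹) ?_ tendsto_inv_atTop_zero
    filter_upwards [eventually_gt_atTop 0] with v hv0
    rw [norm_neg, Real.norm_of_nonneg (mul_nonneg (by positivity) (hexp v).1)]
    exact mul_le_of_le_one_right (by positivity) (hexp v).2.1
  -- Setting the antiderivative to `0` for `v ≤ 0` makes its continuity from the right at `0` the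
  -- limit `hzero`.
  have key := integral_Ioi_of_hasDerivAt_of_tendsto
    (f := fun v : ℝ => if v ≤ 0 then 0 else -(v⁻¹ * (1 - Real.exp (-a * v ^ 2)))) (a := 0) (m := 0)
    (f' := fun v => v ^ (-2 : ℝ) * (1 - Real.exp (-a * v ^ 2)) - 2 * a * Real.exp (-a * v ^ 2))
    (by
      refine continuousWithinAt_Ioi_iff_Ici.1 ?_
      simp only [ContinuousWithinAt, le_refl, if_true]
      refine hzero.congr' ?_
      filter_upwards [self_mem_nhdsWithin] with v hv
      rw [if_neg (not_le.2 hv)])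
    (fun v hv => (hderiv v hv).congr_of_eventuallyEq (by
      filter_upwards [Ioi_mem_nhds hv] with w hw
      rw [if_neg (not_le.2 hw)]))
    (hint.sub hg) (hinf.congr' (by
      filter_upwards [eventually_gt_atTop 0] with v hv
      rw [if_neg (not_le.2 hv)]))
  simp only [le_refl, if_true, sub_zero] at key
  rw [integral_sub hint hg, sub_eq_zero, integral_const_mul, integral_gaussian_Ioi] at key
  rw [key, show Real.pi * a = Real.pi / a * a ^ 2 by field_simp, Real.sqrt_mul (by positivity),
    Real.sqrt_sq ha.le]
  ring

/-- The substitution `u = 1 / v` in the previous integral. -/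
theorem integral_one_sub_exp_neg_div_sq {a : ℝ} (ha : 0 ≤ a) :
    IntegrableOn (fun u : ℝ => 1 - Real.exp (-a / u ^ 2)) (Set.Ioi 0) ∧
    ∫ u in Set.Ioi (0 : ℝ), (1 - Real.exp (-a / u ^ 2)) = √(Real.pi * a) := by
  rcases ha.eq_or_lt with rfl | ha
  · simp
  obtain ⟨h1, h2⟩ := integral_one_sub_exp_neg_mul_sq_div_sq ha
  have heq : ∀ v ∈ Set.Ioi (0 : ℝ), (|(-1 : ℝ)| * v ^ ((-1 : ℝ) - 1)) •
      (1 - Real.exp (-a / (v ^ (-1 : ℝ)) ^ 2)) = v ^ (-2 : ℝ) * (1 - Real.exp (-a * v ^ 2)) := by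
    intro v hv
    have hv0 : (0 : ℝ) < v := hv
    rw [Real.rpow_neg_one]
    norm_num
  constructor
  · rw [← integrableOn_Ioi_comp_rpow_iff (fun u : ℝ => 1 - Real.exp (-a / u ^ 2))
      (p := -1) (by norm_num)]
    exact h1.congr_fun (fun v hv => (heq v hv).symm) measurableSet_Ioi
  · rw [← h2, ← integral_comp_rpow_Ioi (fun u : ℝ => 1 - Real.exp (-a / u ^ 2))
      (p := -1) (by norm_num)]
    exact setIntegral_congr_fun measurableSet_Ioi heq

/-- Taken with `c = ‖ω‖`, this exhibits the singular weight `‖ω‖ ^ (-(d + 1))` as a mixture of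
Gaussians in `ω`. -/
theorem integral_pow_mul_exp_neg_sq_mul (d : ℕ) {c : ℝ} (hc : 0 < c) :
    IntegrableOn (fun u : ℝ => u ^ d * Real.exp (-(u ^ 2 * c ^ 2))) (Set.Ioi 0) ∧
    ∫ u in Set.Ioi (0 : ℝ), u ^ d * Real.exp (-(u ^ 2 * c ^ 2)) =
      Real.Gamma ((d + 1) / 2) / 2 / c ^ (d + 1) := by
  have heq : ∀ u ∈ Set.Ioi (0 : ℝ), u ^ (d : ℝ) * Real.exp (-(c ^ 2) * u ^ (2 : ℝ)) =
      u ^ d * Real.exp (-(u ^ 2 * c ^ 2)) := fun u _ => by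
    rw [Real.rpow_natCast, Real.rpow_two]; ring_nf
  have hd : (-1 : ℝ) < d := by linarith [(Nat.cast_nonneg d : (0 : ℝ) ≤ d)]
  constructor
  · exact (integrableOn_rpow_mul_exp_neg_mul_rpow hd two_pos (b := c ^ 2)
      (by positivity)).congr_fun heq measurableSet_Ioi
  · rw [← setIntegral_congr_fun measurableSet_Ioi heq,
      integral_rpow_mul_exp_neg_mul_rpow two_pos hd (sq_pos_of_pos hc)]
    have : (c ^ 2) ^ (-((d : ℝ) + 1) / 2) = (c ^ (d + 1))⁻¹ := by
      rw [← Real.rpow_natCast c 2, ← Real.rpow_mul hc.le, ← Real.rpow_natCast c (d + 1),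
        ← Real.rpow_neg hc.le]
      congr 1
      push_cast
      ring
    rw [this]
    field_simp

/-- The Fourier transform of the Gaussian, in real form. -/
theorem integral_one_sub_cos_mul_gaussian {d : ℕ} (x : Euc d) {u : ℝ} (hu : 0 < u) :
    Integrable (fun ω : Euc d => (1 - Real.cos (inner ℝ ω x)) * Real.exp (-(u ^ 2 * ‖ω‖ ^ 2))) ∧
    ∫ ω : Euc d, (1 - Real.cos (inner ℝ ω x)) * Real.exp (-(u ^ 2 * ‖ω‖ ^ 2)) =
      √Real.pi ^ d / u ^ d * (1 - Real.exp (-(‖x‖ ^ 2 / 4) / u ^ 2)) := by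
  have hb : 0 < ((u ^ 2 : ℝ) : ℂ).re := by rw [Complex.ofReal_re]; positivity
  have hi : ∀ y : Euc d, Integrable fun ω : Euc d =>
      Real.cos (inner ℝ ω y) * Real.exp (-(u ^ 2 * ‖ω‖ ^ 2)) := by
    intro y
    have := (GaussianFourier.integrable_cexp_neg_mul_sq_norm_add hb Complex.I y).re
    refine this.congr (.of_forall fun ω => ?_)
    simp only [RCLike.re_eq_complex_re]
    rw [show (-((u ^ 2 : ℝ) : ℂ) * (‖ω‖ : ℂ) ^ 2 + Complex.I * (inner ℝ y ω : ℝ)) =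
      ((-(u ^ 2 * ‖ω‖ ^ 2) : ℝ) : ℂ) + ((inner ℝ ω y : ℝ) : ℂ) * Complex.I by
        rw [real_inner_comm]; push_cast; ring]
    rw [Complex.exp_add, ← Complex.ofReal_exp, Complex.re_ofReal_mul,
      Complex.exp_ofReal_mul_I_re, mul_comm]
  have hv : ∀ y : Euc d, ∫ ω : Euc d,
      Real.cos (inner ℝ ω y) * Real.exp (-(u ^ 2 * ‖ω‖ ^ 2)) =
      √Real.pi ^ d / u ^ d * Real.exp (-(‖y‖ ^ 2 / 4) / u ^ 2) := by
    intro y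
    have h := GaussianFourier.integral_cexp_neg_mul_sq_norm_add hb Complex.I y
    have h' := congrArg Complex.re h
    rw [← RCLike.re_eq_complex_re, ← integral_re
      (GaussianFourier.integrable_cexp_neg_mul_sq_norm_add hb Complex.I y)] at h'
    simp only [RCLike.re_eq_complex_re] at h'
    convert h' using 1
    · refine integral_congr_ae (.of_forall fun ω => ?_)
      simp only
      rw [show (-((u ^ 2 : ℝ) : ℂ) * (‖ω‖ : ℂ) ^ 2 + Complex.I * (inner ℝ y ω : ℝ)) =
        ((-(u ^ 2 * ‖ω‖ ^ 2) : ℝ) : ℂ) + ((inner ℝ ω y : ℝ) : ℂ) * Complex.I by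
          rw [real_inner_comm]; push_cast; ring]
      rw [Complex.exp_add, ← Complex.ofReal_exp, Complex.re_ofReal_mul,
        Complex.exp_ofReal_mul_I_re, mul_comm]
    · have e1 : ((Real.pi : ℂ) / ((u ^ 2 : ℝ) : ℂ)) ^ ((Module.finrank ℝ (Euc d) : ℂ) / 2) =
          ((√Real.pi ^ d / u ^ d : ℝ) : ℂ) := by
        rw [← Complex.ofReal_div, finrank_euc,
          show ((d : ℂ) / 2) = (((d : ℝ) / 2 : ℝ) : ℂ) by push_cast; rfl,
          ← Complex.ofReal_cpow (by positivity)]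
        congr 1
        rw [← div_pow, ← Real.rpow_natCast, Real.sqrt_eq_rpow]
        rw [show Real.pi ^ (1 / 2 : ℝ) / u = (Real.pi / u ^ 2) ^ (1 / 2 : ℝ) by
          rw [Real.div_rpow (by positivity) (by positivity), ← Real.sqrt_eq_rpow (u ^ 2),
            Real.sqrt_sq hu.le]]
        rw [← Real.rpow_natCast _ d, ← Real.rpow_mul (by positivity)]
        norm_num
        ring_nf
      have e2 : (Complex.I ^ 2 * (‖y‖ : ℂ) ^ 2 / (4 * ((u ^ 2 : ℝ) : ℂ))) =
          ((-(‖y‖ ^ 2 / 4) / u ^ 2 : ℝ) : ℂ) := by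
        have : (u : ℂ) ≠ 0 := by exact_mod_cast hu.ne'
        rw [Complex.I_sq]; push_cast; field_simp
      rw [e1, e2, ← Complex.ofReal_exp, ← Complex.ofReal_mul, Complex.ofReal_re]
  have h0 : Integrable fun ω : Euc d => Real.exp (-(u ^ 2 * ‖ω‖ ^ 2)) := by simpa using hi 0
  have h0v : ∫ ω : Euc d, Real.exp (-(u ^ 2 * ‖ω‖ ^ 2)) = √Real.pi ^ d / u ^ d := by
    simpa using hv 0
  simp only [sub_mul, one_mul]
  refine ⟨h0.sub (hi x), ?_⟩
  rw [integral_sub h0 (hi x), h0v, hv x]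
  ring

theorem energyConst_eq (d : ℕ) :
    energyConst d = 2 * √Real.pi ^ (d + 1) / Real.Gamma ((d + 1) / 2) := by
  rw [energyConst, sphereArea, surfaceMeasure, Measure.toSphere_real_apply_univ, finrank_euc,
    measureReal_def, EuclideanSpace.volume_ball]
  have h : ((d + 1 : ℕ) : ℝ) / 2 ≠ 0 := by positivity
  simp only [ENNReal.ofReal_one, one_pow, one_mul, Fintype.card_fin]
  rw [Real.Gamma_add_one h, ENNReal.toReal_ofReal (by positivity)]
  have := Real.Gamma_pos_of_pos (show 0 < ((d : ℝ) + 1) / 2 by positivity)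
  push_cast
  field_simp

theorem energyConst_pos (d : ℕ) : 0 < energyConst d := by
  rw [energyConst_eq]
  have := Real.Gamma_pos_of_pos (show 0 < ((d : ℝ) + 1) / 2 by positivity)
  positivity

/-- The weight is replaced by its mixture of Gaussians and the integrals are exchanged. The integral
over `ω` is then a Gaussian Fourier transform, and a one-dimensional integral in `u` remains. With
`ℝ≥0∞`-valued integrals the exchange needs only measurability, and integrability follows from the
finite value. -/
theorem lintegral_one_sub_cos_div {d : ℕ} (hd : 1 < d) (x : Euc d) :
    ∫⁻ ω : Euc d, ENNReal.ofReal ((1 - Real.cos (inner ℝ ω x)) / ‖ω‖ ^ (d + 1)) =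
      ENNReal.ofReal (energyConst d / 2 * ‖x‖) := by
  have := nontrivial_euc hd
  have hG := Real.Gamma_pos_of_pos (show 0 < ((d : ℝ) + 1) / 2 by positivity)
  set G := Real.Gamma (((d : ℝ) + 1) / 2)
  have hcos : ∀ t : ℝ, 0 ≤ 1 - Real.cos t := fun t => by linarith [Real.cos_le_one t]
  have h1 : ∀ᵐ ω : Euc d, ENNReal.ofReal ((1 - Real.cos (inner ℝ ω x)) / ‖ω‖ ^ (d + 1)) =
      ∫⁻ u in Set.Ioi (0 : ℝ), ENNReal.ofReal (2 / G * u ^ d *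
        ((1 - Real.cos (inner ℝ ω x)) * Real.exp (-(u ^ 2 * ‖ω‖ ^ 2)))) := by
    filter_upwards [Measure.ae_ne volume (0 : Euc d)] with ω hω
    have hω' : 0 < ‖ω‖ := norm_pos_iff.2 hω
    obtain ⟨i1, i2⟩ := integral_pow_mul_exp_neg_sq_mul d hω'
    have i3 : ∀ u : ℝ, 2 / G * u ^ d *
        ((1 - Real.cos (inner ℝ ω x)) * Real.exp (-(u ^ 2 * ‖ω‖ ^ 2))) =
        2 / G * (1 - Real.cos (inner ℝ ω x)) * (u ^ d * Real.exp (-(u ^ 2 * ‖ω‖ ^ 2))) :=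
      fun u => by ring
    simp only [i3]
    rw [← ofReal_integral_eq_lintegral_ofReal (i1.const_mul _), integral_const_mul, i2]
    · congr 1
      change _ = _ * (G / 2 / _)
      field_simp
    · filter_upwards [ae_restrict_mem measurableSet_Ioi] with u hu
      have hu0 : (0 : ℝ) < u := hu
      have := hcos (inner ℝ ω x)
      simp only [Pi.zero_apply]
      positivity
  rw [lintegral_congr_ae h1, lintegral_lintegral_swap (by fun_prop)]
  have h2 : ∀ u ∈ Set.Ioi (0 : ℝ), ∫⁻ ω : Euc d, ENNReal.ofReal (2 / G * u ^ d *
        ((1 - Real.cos (inner ℝ ω x)) * Real.exp (-(u ^ 2 * ‖ω‖ ^ 2)))) =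
      ENNReal.ofReal (2 / G * √Real.pi ^ d * (1 - Real.exp (-(‖x‖ ^ 2 / 4) / u ^ 2))) := by
    intro u hu
    have hu0 : (0 : ℝ) < u := hu
    obtain ⟨i1, i2⟩ := integral_one_sub_cos_mul_gaussian x hu0
    rw [← ofReal_integral_eq_lintegral_ofReal (i1.const_mul _), integral_const_mul, i2]
    · congr 1
      field_simp
    · refine .of_forall fun ω => ?_
      have := hcos (inner ℝ ω x)
      simp only [Pi.zero_apply]
      positivity
  rw [setLIntegral_congr_fun measurableSet_Ioi h2]
  obtain ⟨i1, i2⟩ := integral_one_sub_exp_neg_div_sq (a := ‖x‖ ^ 2 / 4) (by positivity)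
  rw [← ofReal_integral_eq_lintegral_ofReal (i1.const_mul _), integral_const_mul, i2]
  · congr 1
    rw [energyConst_eq, Real.sqrt_mul (by positivity), show ‖x‖ ^ 2 / 4 = (‖x‖ / 2) ^ 2 by ring,
      Real.sqrt_sq (by positivity)]
    ring
  · refine .of_forall fun u => ?_
    have : Real.exp (-(‖x‖ ^ 2 / 4) / u ^ 2) ≤ 1 := Real.exp_le_one_iff.2
      (div_nonpos_of_nonpos_of_nonneg (by simp; positivity) (by positivity))
    simp only [Pi.zero_apply]
    have : 0 ≤ 1 - Real.exp (-(‖x‖ ^ 2 / 4) / u ^ 2) := by linarith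
    positivity

theorem integral_one_sub_cos_div {d : ℕ} (hd : 1 < d) (x : Euc d) :
    Integrable (fun ω : Euc d => (1 - Real.cos (inner ℝ ω x)) / ‖ω‖ ^ (d + 1)) ∧
    ∫ ω : Euc d, (1 - Real.cos (inner ℝ ω x)) / ‖ω‖ ^ (d + 1) = energyConst d / 2 * ‖x‖ := by
  have hm : AEStronglyMeasurable
      (fun ω : Euc d => (1 - Real.cos (inner ℝ ω x)) / ‖ω‖ ^ (d + 1)) volume :=
    (show Measurable _ by fun_prop).aestronglyMeasurable
  have hnn : 0 ≤ᵐ[volume] fun ω : Euc d => (1 - Real.cos (inner ℝ ω x)) / ‖ω‖ ^ (d + 1) :=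
    .of_forall fun ω => div_nonneg (by linarith [Real.cos_le_one (inner ℝ ω x)]) (by positivity)
  have h := lintegral_one_sub_cos_div hd x
  have := energyConst_pos d
  constructor
  · exact (lintegral_ofReal_ne_top_iff_integrable hm hnn).1 (by rw [h]; exact ENNReal.ofReal_ne_top)
  · rw [integral_eq_lintegral_of_nonneg_ae hnn hm, h, ENNReal.toReal_ofReal (by positivity)]

/-! ### The energy distance in terms of characteristic functions. -/

/-- By independence the expectation of `e^(i⟨X - Y, ω⟩)` is `φ_P` times the conjugate of `φ_Q`; the
cosine is the real part. -/
theorem integral_one_sub_cos_prod {d : ℕ} (P Q : Measure (Euc d)) [IsProbabilityMeasure P]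
    [IsProbabilityMeasure Q] (ω : Euc d) :
    ∫ z, (1 - Real.cos (inner ℝ ω (z.1 - z.2))) ∂(P.prod Q) =
      1 - (charFun P ω * (starRingEnd ℂ) (charFun Q ω)).re := by
  have hb : ∀ (ω : Euc d) (x : Euc d), ‖Complex.exp ((inner ℝ x ω : ℝ) * Complex.I)‖ = 1 :=
    fun ω x => Complex.norm_exp_ofReal_mul_I _
  have hi : Integrable (fun z : Euc d × Euc d =>
      Complex.exp ((inner ℝ (z.1 - z.2) ω : ℝ) * Complex.I)) (P.prod Q) := by
    refine Integrable.of_bound (by fun_prop) 1 (.of_forall fun z => (hb ω _).le)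
  have h1 : charFun P ω * (starRingEnd ℂ) (charFun Q ω) =
      ∫ z, Complex.exp ((inner ℝ (z.1 - z.2) ω : ℝ) * Complex.I) ∂(P.prod Q) := by
    rw [← charFun_neg, charFun_apply, charFun_apply, ← integral_prod_mul]
    refine integral_congr_ae (.of_forall fun z => ?_)
    simp only
    rw [← Complex.exp_add, inner_sub_left, inner_neg_right]
    push_cast
    ring_nf
  have h2 : (charFun P ω * (starRingEnd ℂ) (charFun Q ω)).re =
      ∫ z, Real.cos (inner ℝ ω (z.1 - z.2)) ∂(P.prod Q) := by
    rw [h1, ← RCLike.re_eq_complex_re, ← integral_re hi]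
    refine integral_congr_ae (.of_forall fun z => ?_)
    simp only [RCLike.re_eq_complex_re]
    rw [Complex.exp_ofReal_mul_I_re, real_inner_comm]
  have h3 : Integrable (fun z : Euc d × Euc d => Real.cos (inner ℝ ω (z.1 - z.2)))
      (P.prod Q) :=
    Integrable.of_bound (by fun_prop) 1 (.of_forall fun z => Real.abs_cos_le_one _)
  rw [integral_sub (integrable_const _) h3, h2]
  simp

/-- Fubini's theorem applies because the integrand is nonnegative and its integral over `ω` is a
multiple of `‖z.1 - z.2‖`, which has finite expectation. -/
theorem integral_norm_sub_eq {d : ℕ} (hd : 1 < d) (P Q : Measure (Euc d)) [IsProbabilityMeasure P]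
    [IsProbabilityMeasure Q] (hP : Integrable (fun x => x) P) (hQ : Integrable (fun x => x) Q) :
    Integrable (fun ω : Euc d => (1 - (charFun P ω * (starRingEnd ℂ) (charFun Q ω)).re) /
      ‖ω‖ ^ (d + 1)) ∧
    ∫ ω : Euc d, (1 - (charFun P ω * (starRingEnd ℂ) (charFun Q ω)).re) / ‖ω‖ ^ (d + 1) =
      energyConst d / 2 * ∫ z, ‖z.1 - z.2‖ ∂(P.prod Q) := by
  have hnn : ∀ (z : Euc d × Euc d) (ω : Euc d),
      0 ≤ (1 - Real.cos (inner ℝ ω (z.1 - z.2))) / ‖ω‖ ^ (d + 1) := fun z ω =>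
    div_nonneg (by linarith [Real.cos_le_one (inner ℝ ω (z.1 - z.2))]) (by positivity)
  have hint : Integrable (Function.uncurry fun (z : Euc d × Euc d) (ω : Euc d) =>
      (1 - Real.cos (inner ℝ ω (z.1 - z.2))) / ‖ω‖ ^ (d + 1)) ((P.prod Q).prod volume) := by
    refine (integrable_prod_iff ?_).2 ⟨.of_forall fun z => ?_, ?_⟩
    · refine Measurable.aestronglyMeasurable ?_
      unfold Function.uncurry
      fun_prop
    · exact (integral_one_sub_cos_div hd (z.1 - z.2)).1
    · simp only [Function.uncurry, Real.norm_of_nonneg (hnn _ _),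
        (integral_one_sub_cos_div hd _).2]
      exact (((hP.comp_fst Q).sub (hQ.comp_snd P)).norm).const_mul _
  have hval : ∀ ω : Euc d, ∫ z, (1 - Real.cos (inner ℝ ω (z.1 - z.2))) / ‖ω‖ ^ (d + 1)
      ∂(P.prod Q) = (1 - (charFun P ω * (starRingEnd ℂ) (charFun Q ω)).re) / ‖ω‖ ^ (d + 1) :=
    fun ω => by rw [integral_div, integral_one_sub_cos_prod]
  constructor
  · have := hint.integral_prod_right
    simpa only [Function.uncurry, hval] using this
  · have := integral_integral_swap hint
    simp only [hval, (integral_one_sub_cos_div hd _).2] at this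
    rw [← this, integral_const_mul]

/-- The energy distance as a weighted `L²` distance of characteristic functions. -/
theorem energyDistSq_eq {d : ℕ} (hd : 1 < d) (P Q : Measure (Euc d)) [IsProbabilityMeasure P]
    [IsProbabilityMeasure Q] (hP : Integrable (fun x => x) P) (hQ : Integrable (fun x => x) Q) :
    Integrable (fun ω : Euc d => ‖charFun P ω - charFun Q ω‖ ^ 2 / ‖ω‖ ^ (d + 1)) ∧
    energyDistSq P Q = 1 / energyConst d *
      ∫ ω : Euc d, ‖charFun P ω - charFun Q ω‖ ^ 2 / ‖ω‖ ^ (d + 1) := by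
  obtain ⟨i1, e1⟩ := integral_norm_sub_eq hd P Q hP hQ
  obtain ⟨i2, e2⟩ := integral_norm_sub_eq hd P P hP hP
  obtain ⟨i3, e3⟩ := integral_norm_sub_eq hd Q Q hQ hQ
  -- This is `|a - b|² = |a|² + |b|² - 2 Re(a b̄)`; the constants cancel, since they enter as `2 - 1
  -- - 1`.
  have heq : ∀ ω : Euc d, ‖charFun P ω - charFun Q ω‖ ^ 2 / ‖ω‖ ^ (d + 1) =
      2 * ((1 - (charFun P ω * (starRingEnd ℂ) (charFun Q ω)).re) / ‖ω‖ ^ (d + 1)) -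
      (1 - (charFun P ω * (starRingEnd ℂ) (charFun P ω)).re) / ‖ω‖ ^ (d + 1) -
      (1 - (charFun Q ω * (starRingEnd ℂ) (charFun Q ω)).re) / ‖ω‖ ^ (d + 1) := fun ω => by
    rw [← Complex.normSq_eq_norm_sq, Complex.normSq_sub, Complex.mul_conj, Complex.mul_conj]
    simp only [Complex.ofReal_re]
    ring
  have hc := energyConst_pos d
  simp only [heq]
  refine ⟨((i1.const_mul 2).sub i2).sub i3, ?_⟩
  rw [integral_sub (f := fun ω : Euc d => _ - _) ((i1.const_mul 2).sub i2) i3, integral_sub (i1.const_mul 2) i2,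
    integral_const_mul, e1, e2, e3, energyDistSq]
  field_simp

/-! ### Partial derivatives along words and the `C⁵` norm. -/

/-- The iterated partial derivative of `f` along the coordinate directions in a list. -/
noncomputable def listDeriv {d : ℕ} (f : Euc d → ℂ) : List (Fin d) → Euc d → ℂ
  | [] => f
  | i :: l => fun x => fderiv ℝ (listDeriv f l) x (EuclideanSpace.single i 1)

theorem contDiff_listDeriv {d n : ℕ} {f : Euc d → ℂ} (hf : ContDiff ℝ n f) (l : List (Fin d))
    (m : ℕ) (h : m + l.length ≤ n) : ContDiff ℝ m (listDeriv f l) := by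
  induction l generalizing m with
  | nil => exact hf.of_le (by exact_mod_cast h)
  | cons i l ih =>
    have h1 : ContDiff ℝ ((m + 1 : ℕ)) (listDeriv f l) :=
      ih (m + 1) (by simp only [List.length_cons] at h; omega)
    have h2 : ContDiff ℝ m (fderiv ℝ (listDeriv f l)) := h1.fderiv_right (by norm_cast)
    exact h2.clm_apply contDiff_const

theorem iteratedFDeriv_single_eq_listDeriv {d n : ℕ} {f : Euc d → ℂ} (hf : ContDiff ℝ n f)
    (l : List (Fin d)) (h : l.length ≤ n) (x : Euc d) :
    iteratedFDeriv ℝ l.length f x (fun k => EuclideanSpace.single (l.get k) (1 : ℝ)) =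
      listDeriv f l x := by
  induction l generalizing x with
  | nil => simp [listDeriv]
  | cons i l ih =>
    have h' : l.length < n := by simpa using h
    have hd : DifferentiableAt ℝ (iteratedFDeriv ℝ l.length f) x :=
      hf.differentiable_iteratedFDeriv (by exact_mod_cast h') x
    change iteratedFDeriv ℝ (l.length + 1) f x _ = _
    rw [hd.iteratedFDeriv_succ_apply_left', listDeriv]
    have : (fun y => iteratedFDeriv ℝ l.length f y (Fin.tail fun k : Fin (l.length + 1) =>
        EuclideanSpace.single ((i :: l).get k) (1 : ℝ))) = listDeriv f l := by
      ext y
      exact ih h'.le y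
    exact congrArg (fun g : Euc d → ℂ => fderiv ℝ g x (EuclideanSpace.single i 1)) this

/-- Differentiation along a ray produces arbitrary words of directions, whereas `normC5` sees only
the ordered words of multi-indices. Exchanging adjacent letters is the symmetry of the second
derivative. -/
theorem listDeriv_perm {d n : ℕ} {f : Euc d → ℂ} (hf : ContDiff ℝ n f) {l l' : List (Fin d)}
    (hp : l.Perm l') (h : l.length ≤ n) : listDeriv f l = listDeriv f l' := by
  induction hp with
  | nil => rfl
  | cons i _ ih => simp only [listDeriv, ih (by simp only [List.length_cons] at h; omega)]
  | swap i j l =>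
    have hc : ContDiff ℝ 2 (listDeriv f l) :=
      contDiff_listDeriv hf l 2 (by simp only [List.length_cons] at h; omega)
    have hd : Differentiable ℝ (fderiv ℝ (listDeriv f l)) :=
      (hc.fderiv_right (m := 1) (by norm_num)).differentiable one_ne_zero
    have key : ∀ (v w x : Euc d), fderiv ℝ (fun y => fderiv ℝ (listDeriv f l) y w) x v =
        fderiv ℝ (fderiv ℝ (listDeriv f l)) x v w := fun v w x => by
      rw [fderiv_clm_apply (hd x) (differentiableAt_const w)]
      simp
    ext x
    simp only [listDeriv, key]
    exact (hc.contDiffAt.isSymmSndFDerivAt (by simp)).eq _ _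
  | trans h1 _ ih1 ih2 => rw [ih1 h, ih2 (h1.length_eq ▸ h)]

theorem multiIndexDirs_count_perm {d : ℕ} (l : List (Fin d)) :
    (multiIndexDirs fun i => l.count i).Perm l := by
  refine List.perm_iff_count.2 fun i => ?_
  rw [multiIndexDirs, List.count_flatMap]
  have : (List.count i ∘ fun j => List.replicate (l.count j) j) =
      fun j => if j = i then l.count i else 0 := by
    ext j
    simp only [Function.comp_apply, List.count_replicate, beq_iff_eq]
    split_ifs with h
    · rw [h]
    · rfl
  rw [this, ← List.ofFn_eq_map, List.sum_ofFn]
  simp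

theorem sum_count_eq_length {d : ℕ} (l : List (Fin d)) : ∑ i, l.count i = l.length := by
  simpa using Multiset.sum_count_eq_card (s := Finset.univ) (m := (l : Multiset (Fin d)))
    (fun _ _ => Finset.mem_univ _)

/-- The letter counts of a word form a multi-index with the same derivative, so the left side is one
of the terms of the sum in `normC5`. -/
theorem enorm_listDeriv_le_normC5 {d : ℕ} {f : Euc d → ℂ} (hf : ContDiff ℝ 5 f)
    {l : List (Fin d)} (h : l.length ≤ 5) {r : ℝ} {x : Euc d} (hx : ‖x‖ ≤ r) :
    ‖listDeriv f l x‖ₑ ≤ normC5 r f := by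
  have hp := multiIndexDirs_count_perm l
  have h1 : listDeriv f l x = multiDeriv (fun i => l.count i) f x := by
    rw [multiDeriv, iteratedFDeriv_single_eq_listDeriv (n := 5) hf _ (hp.length_eq ▸ h),
      listDeriv_perm (n := 5) hf hp (hp.length_eq ▸ h)]
  rw [h1, normC5]
  refine le_trans ?_ (le_iSup₂ (f := fun (ω : Euc d) (_ : ω ∈ Metric.closedBall (0 : Euc d) r) =>
    ∑ k ∈ Finset.range 6, ∑ α ∈ Finset.piAntidiag (Finset.univ : Finset (Fin d)) k,
      ‖multiDeriv α f ω‖ₑ) x (by simpa using hx))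
  refine le_trans ?_ (Finset.single_le_sum (f := fun k =>
    ∑ α ∈ Finset.piAntidiag (Finset.univ : Finset (Fin d)) k, ‖multiDeriv α f x‖ₑ)
    (fun _ _ => zero_le) (Finset.mem_range.2 (Nat.lt_succ_of_le h)))
  exact Finset.single_le_sum (f := fun α => ‖multiDeriv α f x‖ₑ) (fun _ _ => zero_le)
    (by simp [sum_count_eq_length])

theorem contDiff_smul_line {d : ℕ} (θ : Euc d) : ContDiff ℝ ⊤ fun s : ℝ => s • θ := by
  fun_prop

/-- Each derivative in `t` is `∑ θ_i ∂_i`: it adds one letter to the word and produces `d` terms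
with `|θ_i| ≤ 1`. The induction on `k` therefore runs over all words `l`. -/
theorem norm_iteratedDeriv_line_le {d n : ℕ} {f : Euc d → ℂ} (hf : ContDiff ℝ n f) {M : ℝ}
    (hM : ∀ l : List (Fin d), l.length ≤ n → ∀ x, ‖x‖ ≤ 1 → ‖listDeriv f l x‖ ≤ M)
    {θ : Euc d} (hθ : ‖θ‖ ≤ 1) (k : ℕ) (l : List (Fin d)) (hk : k + l.length ≤ n) {t : ℝ}
    (ht : |t| ≤ 1) :
    ‖iteratedDeriv k (fun s : ℝ => listDeriv f l (s • θ)) t‖ ≤ d ^ k * M := by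
  induction k generalizing l with
  | zero =>
    simp only [iteratedDeriv_zero, pow_zero, one_mul]
    refine hM l (by omega) _ ?_
    rw [norm_smul, Real.norm_eq_abs]
    exact mul_le_one₀ ht (norm_nonneg _) hθ
  | succ k ih =>
    have hder : deriv (fun s : ℝ => listDeriv f l (s • θ)) =
        fun s => ∑ i, (θ i : ℂ) * listDeriv f (i :: l) (s • θ) := by
      ext s
      have hd : DifferentiableAt ℝ (listDeriv f l) (s • θ) :=
        (contDiff_listDeriv hf l 1 (by omega)).differentiable one_ne_zero _
      have h1 : HasDerivAt (fun s : ℝ => s • θ) θ s := by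
        simpa using (hasDerivAt_id s).smul_const θ
      have h3 : HasDerivAt (fun s : ℝ => listDeriv f l (s • θ))
          (fderiv ℝ (listDeriv f l) (s • θ) θ) s := hd.hasFDerivAt.comp_hasDerivAt s h1
      rw [h3.deriv]
      have h2 : θ = ∑ i, θ i • EuclideanSpace.single i (1 : ℝ) := by
        ext j
        simp [Finset.sum_apply, Pi.single_apply]
      nth_rw 2 [h2]
      rw [map_sum]
      simp [listDeriv]
    rw [iteratedDeriv_succ', hder]
    have hc : ∀ i, ContDiffAt ℝ k (fun s : ℝ => (θ i : ℂ) * listDeriv f (i :: l) (s • θ)) t :=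
      fun i => (contDiff_const.mul ((contDiff_listDeriv hf (i :: l) k
        (by simp only [List.length_cons]; omega)).comp
        ((contDiff_smul_line θ).of_le le_top))).contDiffAt
    rw [iteratedDeriv_fun_sum fun i _ => hc i]
    refine (norm_sum_le _ _).trans ?_
    have : ∀ i ∈ Finset.univ, ‖iteratedDeriv k
        (fun s : ℝ => (θ i : ℂ) * listDeriv f (i :: l) (s • θ)) t‖ ≤ d ^ k * M := fun i _ => by
      rw [iteratedDeriv_const_mul_field, norm_mul]
      have h1 := ih (i :: l) (by simp only [List.length_cons]; omega)
      have h2 : ‖(θ i : ℂ)‖ ≤ 1 := by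
        rw [Complex.norm_real]
        exact (abs_coord_le θ i).trans hθ
      exact (mul_le_of_le_one_left (norm_nonneg _) h2).trans h1
    refine (Finset.sum_le_card_nsmul _ _ _ this).trans_eq ?_
    simp
    ring

/-! ### Taylor expansion on a ray and the algebra of `|F - 1|² / |F|`. -/

/-- The third order Taylor expansion at the origin, with remainder. -/
theorem norm_sub_cubic_taylor_le {F : ℝ → ℂ} (hF : ContDiff ℝ 5 F) {M : ℝ}
    (hM : ∀ t, |t| ≤ 1 → ‖iteratedDeriv 4 F t‖ ≤ M) {t : ℝ} (ht : t ∈ Set.Icc (0 : ℝ) 1) :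
    ‖F t - (F 0 + t * iteratedDeriv 1 F 0 + t ^ 2 / 2 * iteratedDeriv 2 F 0 +
      t ^ 3 / 6 * iteratedDeriv 3 F 0)‖ ≤ M * t ^ 4 := by
  have hw : ∀ k : ℕ, k ≤ 5 → ∀ y ∈ Set.Icc (0 : ℝ) 1,
      iteratedDerivWithin k F (Set.Icc 0 1) y = iteratedDeriv k F y := fun k hk y hy =>
    iteratedDerivWithin_eq_iteratedDeriv (uniqueDiffOn_Icc one_pos)
      (hF.of_le (by exact_mod_cast hk)).contDiffAt hy
  have h := taylor_mean_remainder_bound (f := F) (n := 3) (C := M) (zero_le_one' ℝ)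
    (hF.of_le (by norm_num)).contDiffOn ht (fun y hy => by
      rw [hw 4 (by norm_num) y hy]
      exact hM y (by rw [abs_of_nonneg hy.1]; exact hy.2))
  rw [taylor_within_apply] at h
  simp only [Finset.sum_range_succ, Finset.sum_range_zero,
    hw 0 (by norm_num) 0 (by simp), hw 1 (by norm_num) 0 (by simp), hw 2 (by norm_num) 0 (by simp),
    hw 3 (by norm_num) 0 (by simp)] at h
  have hM0 : 0 ≤ M := (norm_nonneg _).trans (hM 0 (by simp))
  have ht0 := ht.1
  refine le_trans (le_of_eq ?_) (h.trans ?_)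
  · congr 2
    simp [Nat.factorial]
    ring
  -- The remainder bound carries a factor `1 / 3!`, which is discarded.
  · simp only [sub_zero, Nat.factorial]
    norm_num
    have : 0 ≤ M * t ^ 4 := by positivity
    linarith

/-- The expansion of `|F - 1|² / |F| = |2 sinh (W / 2)|²` for `F = e^W` in terms of the cumulants
in `W = i μ t - Δ t² / 2 - i κ t³ / 6 + O(t⁴)`. -/
theorem exists_bound_norm_sub_one_sq_div (M : ℝ) (hM : 1 ≤ M) : ∃ C : ℝ, 0 ≤ C ∧
    ∀ (μ Δ κ t : ℝ) (ε F : ℂ), |μ| ≤ M → |Δ| ≤ M → |κ| ≤ M → 0 ≤ t → t ≤ 1 → ‖ε‖ ≤ M → F ≠ 0 →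
      ‖F‖⁻¹ ≤ M →
      F = 1 + (Complex.I * (μ * t) - (μ ^ 2 + Δ) / 2 * t ^ 2 -
        Complex.I * ((μ ^ 3 + 3 * μ * Δ + κ) / 6 * t ^ 3) + ε * t ^ 4) →
      |‖F - 1‖ ^ 2 / ‖F‖ - (μ ^ 2 * t ^ 2 + (3 * Δ ^ 2 - μ ^ 4 - 4 * μ * κ) / 12 * t ^ 4)| ≤
        C * t ^ 5 := by
  -- The variables are `(μ, Δ, κ, Re ε, Im ε, t)`. The polynomials are chosen so that `|F|² = 1 - Δ
  -- t² + t³ E1` and `|F - 1|² = t² S0 (1 - Δ t² / 2) + t⁵ E3` hold exactly, with `t² S0` the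
  -- claimed leading part. Their boundedness on a compact ball makes the constant uniform.
  let a : ℝ × ℝ × ℝ × ℝ × ℝ × ℝ → ℝ := fun p =>
    -(p.1 ^ 2 + p.2.1) / 2 + p.2.2.2.1 * p.2.2.2.2.2 ^ 2
  let s : ℝ × ℝ × ℝ × ℝ × ℝ × ℝ → ℝ := fun p => (p.1 ^ 3 + 3 * p.1 * p.2.1 + p.2.2.1) / 6
  let E1 : ℝ × ℝ × ℝ × ℝ × ℝ × ℝ → ℝ := fun p =>
    2 * p.2.2.2.1 * p.2.2.2.2.2 + a p ^ 2 * p.2.2.2.2.2 - 2 * p.1 * s p * p.2.2.2.2.2 +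
      2 * p.1 * p.2.2.2.2.1 * p.2.2.2.2.2 ^ 2 +
      (-s p + p.2.2.2.2.1 * p.2.2.2.2.2) ^ 2 * p.2.2.2.2.2 ^ 3
  let S0 : ℝ × ℝ × ℝ × ℝ × ℝ × ℝ → ℝ := fun p =>
    p.1 ^ 2 + (3 * p.2.1 ^ 2 - p.1 ^ 4 - 4 * p.1 * p.2.2.1) / 12 * p.2.2.2.2.2 ^ 2
  let E3 : ℝ × ℝ × ℝ × ℝ × ℝ × ℝ → ℝ := fun p =>
    -(p.1 ^ 2 + p.2.1) * p.2.2.2.1 * p.2.2.2.2.2 + p.2.2.2.1 ^ 2 * p.2.2.2.2.2 ^ 3 +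
      2 * p.1 * p.2.2.2.2.1 + (-s p + p.2.2.2.2.1 * p.2.2.2.2.2) ^ 2 * p.2.2.2.2.2 +
      p.2.1 / 2 * ((3 * p.2.1 ^ 2 - p.1 ^ 4 - 4 * p.1 * p.2.2.1) / 12) * p.2.2.2.2.2
  have hcpt : IsCompact (Metric.closedBall (0 : ℝ × ℝ × ℝ × ℝ × ℝ × ℝ) M) :=
    isCompact_closedBall 0 M
  obtain ⟨C1, hC1⟩ := hcpt.exists_bound_of_continuousOn (f := E1) (by fun_prop)
  obtain ⟨C2, hC2⟩ := hcpt.exists_bound_of_continuousOn (f := S0) (by fun_prop)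
  obtain ⟨C3, hC3⟩ := hcpt.exists_bound_of_continuousOn (f := E3) (by fun_prop)
  have h0 : (0 : ℝ × ℝ × ℝ × ℝ × ℝ × ℝ) ∈ Metric.closedBall 0 M := by
    simp; linarith
  have hC1' : 0 ≤ C1 := (norm_nonneg _).trans (hC1 0 h0)
  have hC2' : 0 ≤ C2 := (norm_nonneg _).trans (hC2 0 h0)
  have hC3' : 0 ≤ C3 := (norm_nonneg _).trans (hC3 0 h0)
  refine ⟨M * (C3 + C2 * C1 / 2 + C2 * (M + C1) ^ 2 / 2), by positivity, ?_⟩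
  intro μ Δ κ t ε F hμ hΔ hκ ht0 ht1 hε hF hFM hFeq
  have hp : (μ, Δ, κ, ε.re, ε.im, t) ∈ Metric.closedBall (0 : ℝ × ℝ × ℝ × ℝ × ℝ × ℝ) M := by
    simp only [Metric.mem_closedBall, dist_zero_right, Prod.norm_def, Real.norm_eq_abs, max_le_iff]
    refine ⟨hμ, hΔ, hκ, (Complex.abs_re_le_norm ε).trans hε, (Complex.abs_im_le_norm ε).trans hε,
      ?_⟩
    rw [abs_of_nonneg ht0]; linarith
  have b1 := hC1 _ hp
  have b2 := hC2 _ hp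
  have b3 := hC3 _ hp
  set e1 := E1 (μ, Δ, κ, ε.re, ε.im, t) with he1
  set s0 := S0 (μ, Δ, κ, ε.re, ε.im, t) with hs0
  set e3 := E3 (μ, Δ, κ, ε.re, ε.im, t) with he3
  simp only [E1, S0, E3, a, s] at he1 hs0 he3
  rw [Real.norm_eq_abs] at b1 b2 b3
  have hF' : F = ((1 - (μ ^ 2 + Δ) / 2 * t ^ 2 + ε.re * t ^ 4 : ℝ) : ℂ) +
      ((μ * t - (μ ^ 3 + 3 * μ * Δ + κ) / 6 * t ^ 3 + ε.im * t ^ 4 : ℝ) : ℂ) * Complex.I := by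
    rw [hFeq]
    nth_rw 1 [← Complex.re_add_im ε]
    push_cast
    ring
  have hre : F.re = 1 - (μ ^ 2 + Δ) / 2 * t ^ 2 + ε.re * t ^ 4 := by
    rw [hF', Complex.add_re, Complex.re_ofReal_mul, Complex.ofReal_re, Complex.I_re]
    ring
  have him : F.im = μ * t - (μ ^ 3 + 3 * μ * Δ + κ) / 6 * t ^ 3 + ε.im * t ^ 4 := by
    rw [hF', Complex.add_im, Complex.im_ofReal_mul, Complex.ofReal_im, Complex.I_im]
    ring
  set D := ‖F‖ with hD
  have hDpos : 0 < D := norm_pos_iff.2 hF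
  have hD2 : D ^ 2 = 1 - Δ * t ^ 2 + t ^ 3 * e1 := by
    rw [hD, ← Complex.normSq_eq_norm_sq, Complex.normSq_apply, hre, him, he1]
    ring
  have hN : ‖F - 1‖ ^ 2 = t ^ 2 * s0 * (1 - Δ / 2 * t ^ 2) + t ^ 5 * e3 := by
    rw [← Complex.normSq_eq_norm_sq, Complex.normSq_apply, Complex.sub_re, Complex.sub_im,
      hre, him, hs0, he3]
    simp only [Complex.one_re, Complex.one_im]
    ring
  have hS : μ ^ 2 * t ^ 2 + (3 * Δ ^ 2 - μ ^ 4 - 4 * μ * κ) / 12 * t ^ 4 = t ^ 2 * s0 := by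
    rw [hs0]; ring
  -- As `D + 1 ≥ 1`, the distance of `D` from `1` is at most that of `D²`.
  have hD1 : |D - 1| ≤ t ^ 2 * (M + C1) := by
    have h1 : |D - 1| * (D + 1) = |D ^ 2 - 1| := by
      rw [show D ^ 2 - 1 = (D - 1) * (D + 1) by ring, abs_mul, abs_of_pos (by linarith : 0 < D + 1)]
    have h2 : |D ^ 2 - 1| ≤ t ^ 2 * (M + C1) := by
      rw [hD2, show 1 - Δ * t ^ 2 + t ^ 3 * e1 - 1 = t ^ 2 * (-Δ + t * e1) by ring, abs_mul,
        abs_of_nonneg (sq_nonneg t)]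
      gcongr
      refine (abs_add_le _ _).trans ?_
      rw [abs_neg, abs_mul, abs_of_nonneg ht0]
      have : t * |e1| ≤ 1 * C1 := by gcongr
      linarith
    have h3 : |D - 1| * 1 ≤ |D - 1| * (D + 1) := by gcongr; linarith
    linarith
  -- The square root is linearised exactly by `D = 1 + (D² - 1) / 2 - (D - 1)² / 2`. Its part `1 - Δ
  -- t² / 2` cancels against `hN`, and `(D - 1)² = O(t⁴)`, so only terms of order at least five
  -- remain.
  have hkey : ‖F - 1‖ ^ 2 - t ^ 2 * s0 * D =
      t ^ 5 * e3 - t ^ 5 * (s0 * e1 / 2) + t ^ 2 * s0 * ((D - 1) ^ 2 / 2) := by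
    rw [hN]
    have : D = 1 + (1 - Δ * t ^ 2 + t ^ 3 * e1 - 1) / 2 - (D - 1) ^ 2 / 2 := by
      rw [← hD2]; ring
    linear_combination (-(t ^ 2 * s0)) * this
  have hb : |‖F - 1‖ ^ 2 - t ^ 2 * s0 * D| ≤
      (C3 + C2 * C1 / 2 + C2 * (M + C1) ^ 2 / 2) * t ^ 5 := by
    rw [hkey]
    have i1 : |t ^ 5 * e3| ≤ t ^ 5 * C3 := by
      rw [abs_mul, abs_of_nonneg (by positivity : 0 ≤ t ^ 5)]
      gcongr
    have i2 : |t ^ 5 * (s0 * e1 / 2)| ≤ t ^ 5 * (C2 * C1 / 2) := by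
      rw [abs_mul, abs_of_nonneg (by positivity : 0 ≤ t ^ 5), abs_div, abs_mul, abs_two]
      gcongr
    have i3 : |t ^ 2 * s0 * ((D - 1) ^ 2 / 2)| ≤ t ^ 5 * (C2 * (M + C1) ^ 2 / 2) := by
      rw [abs_mul, abs_mul, abs_of_nonneg (sq_nonneg t), abs_div, abs_two, abs_pow]
      have : |D - 1| ^ 2 ≤ (t ^ 2 * (M + C1)) ^ 2 := by gcongr
      calc t ^ 2 * |s0| * (|D - 1| ^ 2 / 2) ≤ t ^ 2 * C2 * ((t ^ 2 * (M + C1)) ^ 2 / 2) := by gcongr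
        _ = t ^ 5 * (C2 * (M + C1) ^ 2 / 2) * t := by ring
        _ ≤ t ^ 5 * (C2 * (M + C1) ^ 2 / 2) := mul_le_of_le_one_right (by positivity) ht1
    have := abs_add_le (t ^ 5 * e3 - t ^ 5 * (s0 * e1 / 2)) (t ^ 2 * s0 * ((D - 1) ^ 2 / 2))
    have := abs_sub (t ^ 5 * e3) (t ^ 5 * (s0 * e1 / 2))
    linarith
  rw [hS, show ‖F - 1‖ ^ 2 / D - t ^ 2 * s0 = D⁻¹ * (‖F - 1‖ ^ 2 - t ^ 2 * s0 * D) by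
    field_simp, abs_mul, abs_of_pos (inv_pos.2 hDpos), mul_assoc M]
  gcongr

/-! ### Moments and cumulants of one-dimensional projections. -/

/-- The moments of the one-dimensional projection of a law. -/
noncomputable def lineMoment {d : ℕ} (P : Measure (Euc d)) (θ : Euc d) (k : ℕ) : ℝ :=
  ∫ x, (inner ℝ x θ) ^ k ∂P

/-- On a ray, the characteristic function of `P` is that of the law of `⟨x, θ⟩`, so the
one-dimensional moment formula applies. -/
theorem iteratedDeriv_charFun_line {d : ℕ} (P : Measure (Euc d)) [IsProbabilityMeasure P]
    (hP : MemLp (fun x : Euc d => x) 3 P) (θ : Euc d) :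
    ContDiff ℝ 3 (fun t : ℝ => charFun P (t • θ)) ∧
    ∀ k ≤ 3, iteratedDeriv k (fun t : ℝ => charFun P (t • θ)) 0 =
      Complex.I ^ k * lineMoment P θ k := by
  have hm : AEMeasurable (fun x : Euc d => inner ℝ x θ) P := by fun_prop
  have hprob : IsProbabilityMeasure (P.map fun x : Euc d => inner ℝ x θ) :=
    Measure.isProbabilityMeasure_map hm
  have heq : (fun t : ℝ => charFun P (t • θ)) = charFun (P.map fun x : Euc d => inner ℝ x θ) := by
    ext t
    rw [charFun_apply, charFun_apply_real, integral_map hm (by fun_prop)]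
    refine integral_congr_ae (.of_forall fun x => ?_)
    simp only
    rw [inner_smul_right]
    push_cast
    rfl
  have hL : MemLp id ((3 : ℕ) : ℝ≥0∞) (P.map fun x : Euc d => inner ℝ x θ) := by
    rw [memLp_map_measure_iff (by fun_prop) hm]
    refine (hP.norm.const_mul ‖θ‖).of_le (by fun_prop) (.of_forall fun x => ?_)
    simp only [Function.comp_apply, id, Real.norm_eq_abs]
    rw [abs_mul, abs_norm, abs_norm, mul_comm]
    exact abs_real_inner_le_norm x θ
  rw [heq]
  refine ⟨contDiff_charFun hL, fun k hk => ?_⟩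
  rw [iteratedDeriv_charFun_zero (hL.mono_exponent (by exact_mod_cast hk)), lineMoment,
    integral_map hm (by fun_prop)]

theorem integrable_of_abs_le_norm_sub_pow {d : ℕ} {P : Measure (Euc d)} [IsProbabilityMeasure P]
    (hP : MemLp (fun x : Euc d => x) 3 P) (c : Euc d) {g : Euc d → ℝ} (hg : Measurable g) {k : ℕ}
    (hk : k ≤ 3) {C : ℝ} (h : ∀ x, |g x| ≤ C * ‖x - c‖ ^ k) : Integrable g P := by
  have h1 : MemLp (fun x : Euc d => x - c) ((k : ℕ) : ℝ≥0∞) P :=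
    (hP.sub (memLp_const c)).mono_exponent (by exact_mod_cast hk)
  exact (h1.integrable_norm_pow'.const_mul C).mono' hg.aestronglyMeasurable
    (.of_forall fun x => h x)

theorem integrable_inner_pow {d : ℕ} {P : Measure (Euc d)} [IsProbabilityMeasure P]
    (hP : MemLp (fun x : Euc d => x) 3 P) (θ : Euc d) {k : ℕ} (hk : k ≤ 3) :
    Integrable (fun x => (inner ℝ x θ) ^ k) P := by
  refine integrable_of_abs_le_norm_sub_pow hP 0 (by fun_prop) hk (C := ‖θ‖ ^ k) fun x => ?_
  rw [abs_pow, sub_zero, ← mul_pow, mul_comm]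
  gcongr
  exact abs_real_inner_le_norm x θ

theorem integrable_centered {d : ℕ} {P : Measure (Euc d)} [IsProbabilityMeasure P]
    (hP : MemLp (fun x : Euc d => x) 3 P) :
    (∀ i, Integrable (fun x => x i) P) ∧
    (∀ i j, Integrable (fun x => (x i - mean P i) * (x j - mean P j)) P) ∧
    ∀ i j k, Integrable (fun x => (x i - mean P i) * (x j - mean P j) * (x k - mean P k)) P := by
  have hle : ∀ (x : Euc d) i, |x i - mean P i| ≤ ‖x - WithLp.toLp 2 (mean P)‖ := fun x i =>
    abs_coord_le (x - WithLp.toLp 2 (mean P)) i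
  refine ⟨fun i => ?_, fun i j => ?_, fun i j k => ?_⟩
  · exact integrable_of_abs_le_norm_sub_pow hP 0 (by fun_prop) (k := 1) (by norm_num) (C := 1)
      fun x => by simpa using abs_coord_le x i
  · refine integrable_of_abs_le_norm_sub_pow hP (WithLp.toLp 2 (mean P)) (by fun_prop) (k := 2)
      (by norm_num) (C := 1) fun x => ?_
    rw [abs_mul, one_mul, pow_two]
    gcongr <;> apply hle
  · refine integrable_of_abs_le_norm_sub_pow hP (WithLp.toLp 2 (mean P)) (by fun_prop) (k := 3)
      (by norm_num) (C := 1) fun x => ?_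
    rw [abs_mul, abs_mul, one_mul, pow_succ, pow_two]
    gcongr <;> apply hle

theorem inner_eq_sum {d : ℕ} (x θ : Euc d) : inner ℝ x θ = ∑ i, θ i * x i := by
  rw [PiLp.inner_apply]
  simp

theorem sum_mul_mean {d : ℕ} {P : Measure (Euc d)} [IsProbabilityMeasure P]
    (hP : MemLp (fun x : Euc d => x) 3 P) (θ : Euc d) :
    ∑ i, θ i * mean P i = lineMoment P θ 1 := by
  have h := (integrable_centered hP).1
  simp only [lineMoment, pow_one, inner_eq_sum]
  rw [integral_finsetSum _ fun i _ => (h i).const_mul _]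
  simp only [integral_const_mul, mean]

theorem inner_sub_lineMoment {d : ℕ} {P : Measure (Euc d)} [IsProbabilityMeasure P]
    (hP : MemLp (fun x : Euc d => x) 3 P) (θ x : Euc d) :
    ∑ i, θ i * (x i - mean P i) = inner ℝ x θ - lineMoment P θ 1 := by
  rw [← sum_mul_mean hP, inner_eq_sum, ← Finset.sum_sub_distrib]
  simp only [mul_sub]

/-- The form is the variance of the projection `⟨x, θ⟩`, expanded in raw moments; the cubic form
below is its third central moment in the same way. -/
theorem sum_mul_cov {d : ℕ} {P : Measure (Euc d)} [IsProbabilityMeasure P]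
    (hP : MemLp (fun x : Euc d => x) 3 P) (θ : Euc d) :
    ∑ i, ∑ j, θ i * cov P i j * θ j = lineMoment P θ 2 - lineMoment P θ 1 ^ 2 := by
  have h := (integrable_centered hP).2.1
  have h1 : ∑ i, ∑ j, θ i * cov P i j * θ j =
      ∫ x, (inner ℝ x θ - lineMoment P θ 1) ^ 2 ∂P := by
    have : ∀ x, (inner ℝ x θ - lineMoment P θ 1) ^ 2 =
        ∑ i, ∑ j, θ i * θ j * ((x i - mean P i) * (x j - mean P j)) := fun x => by
      rw [← inner_sub_lineMoment hP, pow_two, Finset.sum_mul_sum]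
      refine Finset.sum_congr rfl fun i _ => Finset.sum_congr rfl fun j _ => by ring
    simp only [this]
    rw [integral_finsetSum _ fun i _ => integrable_finsetSum _ fun j _ => (h i j).const_mul _]
    refine Finset.sum_congr rfl fun i _ => ?_
    rw [integral_finsetSum _ fun j _ => (h i j).const_mul _]
    refine Finset.sum_congr rfl fun j _ => ?_
    rw [integral_const_mul, cov]
    ring
  have i1 := integrable_inner_pow hP θ (k := 1) (by norm_num)
  have i2 := integrable_inner_pow hP θ (k := 2) (by norm_num)
  have h2 : ∀ x : Euc d, (inner ℝ x θ - lineMoment P θ 1) ^ 2 = inner ℝ x θ ^ 2 -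
      2 * lineMoment P θ 1 * inner ℝ x θ ^ 1 + lineMoment P θ 1 ^ 2 := fun x => by ring
  rw [h1]
  simp only [h2]
  rw [integral_add (f := fun x => _ - _) (i2.sub (i1.const_mul _)) (integrable_const _),
    integral_sub i2 (i1.const_mul _), integral_const_mul]
  change lineMoment P θ 2 - _ * lineMoment P θ 1 + _ = _
  simp
  ring

theorem sum_mul_centralMoment₃ {d : ℕ} {P : Measure (Euc d)} [IsProbabilityMeasure P]
    (hP : MemLp (fun x : Euc d => x) 3 P) (θ : Euc d) :
    ∑ i, ∑ j, ∑ k, centralMoment₃ P i j k * θ i * θ j * θ k = lineMoment P θ 3 -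
      3 * lineMoment P θ 1 * lineMoment P θ 2 + 2 * lineMoment P θ 1 ^ 3 := by
  have h := (integrable_centered hP).2.2
  have h1 : ∑ i, ∑ j, ∑ k, centralMoment₃ P i j k * θ i * θ j * θ k =
      ∫ x, (inner ℝ x θ - lineMoment P θ 1) ^ 3 ∂P := by
    have : ∀ x, (inner ℝ x θ - lineMoment P θ 1) ^ 3 = ∑ i, ∑ j, ∑ k,
        θ i * θ j * θ k * ((x i - mean P i) * (x j - mean P j) * (x k - mean P k)) := fun x => by
      rw [← inner_sub_lineMoment hP, pow_succ, pow_two, Finset.sum_mul_sum, Finset.sum_mul]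
      refine Finset.sum_congr rfl fun i _ => ?_
      rw [Finset.sum_mul_sum]
      refine Finset.sum_congr rfl fun j _ => Finset.sum_congr rfl fun k _ => by ring
    simp only [this]
    rw [integral_finsetSum _ fun i _ => integrable_finsetSum _ fun j _ =>
      integrable_finsetSum _ fun k _ => (h i j k).const_mul _]
    refine Finset.sum_congr rfl fun i _ => ?_
    rw [integral_finsetSum _ fun j _ => integrable_finsetSum _ fun k _ => (h i j k).const_mul _]
    refine Finset.sum_congr rfl fun j _ => ?_
    rw [integral_finsetSum _ fun k _ => (h i j k).const_mul _]
    refine Finset.sum_congr rfl fun k _ => ?_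
    rw [integral_const_mul, centralMoment₃]
    ring
  have i1 := integrable_inner_pow hP θ (k := 1) (by norm_num)
  have i2 := integrable_inner_pow hP θ (k := 2) (by norm_num)
  have i3 := integrable_inner_pow hP θ (k := 3) (by norm_num)
  have h2 : ∀ x : Euc d, (inner ℝ x θ - lineMoment P θ 1) ^ 3 = inner ℝ x θ ^ 3 -
      3 * lineMoment P θ 1 * inner ℝ x θ ^ 2 + 3 * lineMoment P θ 1 ^ 2 * inner ℝ x θ ^ 1 -
      lineMoment P θ 1 ^ 3 := fun x => by ring
  rw [h1]
  simp only [h2]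
  rw [integral_sub (f := fun x => _ + _) ((i3.sub (i2.const_mul _)).add (i1.const_mul _))
    (integrable_const _), integral_add (f := fun x => _ - _) (i3.sub (i2.const_mul _))
    (i1.const_mul _), integral_sub i3 (i2.const_mul _), integral_const_mul, integral_const_mul]
  change lineMoment P θ 3 - _ * lineMoment P θ 2 + _ * lineMoment P θ 1 - _ = _
  simp
  ring

theorem meanForm_eq {d : ℕ} {P Q : Measure (Euc d)} [IsProbabilityMeasure P]
    [IsProbabilityMeasure Q] (hP : MemLp (fun x : Euc d => x) 3 P)
    (hQ : MemLp (fun x : Euc d => x) 3 Q) (θ : Euc d) :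
    meanForm P Q θ = lineMoment P θ 1 - lineMoment Q θ 1 := by
  rw [← sum_mul_mean hP, ← sum_mul_mean hQ, meanForm, ← Finset.sum_sub_distrib]
  simp only [meanDiff, mul_sub]

theorem covForm_eq {d : ℕ} {P Q : Measure (Euc d)} [IsProbabilityMeasure P]
    [IsProbabilityMeasure Q] (hP : MemLp (fun x : Euc d => x) 3 P)
    (hQ : MemLp (fun x : Euc d => x) 3 Q) (θ : Euc d) :
    covForm P Q θ = (lineMoment P θ 2 - lineMoment P θ 1 ^ 2) -
      (lineMoment Q θ 2 - lineMoment Q θ 1 ^ 2) := by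
  rw [← sum_mul_cov hP, ← sum_mul_cov hQ, covForm]
  simp only [← Finset.sum_sub_distrib, covDiff, Matrix.of_apply, mul_sub, sub_mul]

theorem skewForm_eq {d : ℕ} {P Q : Measure (Euc d)} [IsProbabilityMeasure P]
    [IsProbabilityMeasure Q] (hP : MemLp (fun x : Euc d => x) 3 P)
    (hQ : MemLp (fun x : Euc d => x) 3 Q) (θ : Euc d) :
    skewForm P Q θ = (lineMoment P θ 3 -
      3 * lineMoment P θ 1 * lineMoment P θ 2 + 2 * lineMoment P θ 1 ^ 3) - (lineMoment Q θ 3 -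
      3 * lineMoment Q θ 1 * lineMoment Q θ 2 + 2 * lineMoment Q θ 1 ^ 3) := by
  rw [← sum_mul_centralMoment₃ hP, ← sum_mul_centralMoment₃ hQ, skewForm]
  simp only [← Finset.sum_sub_distrib, skewDiff, sub_mul]

/-- The derivatives at the origin of the quotient of the characteristic functions along a line. -/
theorem iteratedDeriv_quotient_line {d : ℕ} {P Q : Measure (Euc d)} [IsProbabilityMeasure P]
    [IsProbabilityMeasure Q] (hP : MemLp (fun x : Euc d => x) 3 P)
    (hQ : MemLp (fun x : Euc d => x) 3 Q) (θ : Euc d) {F : ℝ → ℂ} (hF : ContDiff ℝ 3 F)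
    (h : ∀ t : ℝ, F t * charFun Q (t • θ) = charFun P (t • θ)) :
    F 0 = 1 ∧ iteratedDeriv 1 F 0 = Complex.I * meanForm P Q θ ∧
    iteratedDeriv 2 F 0 = -(meanForm P Q θ ^ 2 + covForm P Q θ) ∧
    iteratedDeriv 3 F 0 = -(Complex.I * (meanForm P Q θ ^ 3 +
      3 * meanForm P Q θ * covForm P Q θ + skewForm P Q θ)) := by
  obtain ⟨cP, dP⟩ := iteratedDeriv_charFun_line P hP θ
  obtain ⟨cQ, dQ⟩ := iteratedDeriv_charFun_line Q hQ θ
  have hmul : (F * fun t : ℝ => charFun Q (t • θ)) = fun t : ℝ => charFun P (t • θ) := funext h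
  have h0 : F 0 = 1 := by simpa using h 0
  -- The Leibniz rule for `F φ_Q = φ_P` is a triangular system: order `k` determines the `k`-th
  -- derivative of `F` from the lower ones, and only three derivatives of the characteristic
  -- functions are used.
  have leib : ∀ k ≤ 3, ∑ i ∈ Finset.range (k + 1), (k.choose i : ℂ) * iteratedDeriv i F 0 *
      (Complex.I ^ (k - i) * lineMoment Q θ (k - i)) = Complex.I ^ k * lineMoment P θ k := by
    intro k hk
    have hk' : (k : WithTop ℕ∞) ≤ 3 := by exact_mod_cast hk
    rw [← dP k hk, ← hmul, iteratedDeriv_mul (hF.of_le hk').contDiffAt (cQ.of_le hk').contDiffAt]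
    refine Finset.sum_congr rfl fun i _ => ?_
    rw [dQ (k - i) (by omega)]
  have z : lineMoment Q θ 0 = 1 := by simp [lineMoment]
  have l1 := leib 1 (by norm_num)
  have l2 := leib 2 (by norm_num)
  have l3 := leib 3 (by norm_num)
  simp only [Finset.sum_range_succ, Finset.sum_range_zero, iteratedDeriv_zero, h0] at l1 l2 l3
  norm_num [z, Complex.I_pow_three] at l1 l2 l3
  have m1 := meanForm_eq hP hQ θ
  have m2 := covForm_eq hP hQ θ
  have m3 := skewForm_eq hP hQ θ
  have e1 : iteratedDeriv 1 F 0 = Complex.I * meanForm P Q θ := by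
    rw [m1]; push_cast; rw [iteratedDeriv_one]; linear_combination l1
  have e2 : iteratedDeriv 2 F 0 = -(meanForm P Q θ ^ 2 + covForm P Q θ) := by
    rw [← iteratedDeriv_one, e1, m1] at l2
    rw [m1, m2]
    push_cast at l2 ⊢
    linear_combination l2 - 2 * (lineMoment P θ 1 - lineMoment Q θ 1) * lineMoment Q θ 1 *
      Complex.I_sq
  refine ⟨h0, e1, e2, ?_⟩
  rw [← iteratedDeriv_one, e1, e2, m1, m2] at l3
  rw [m1, m2, m3]
  push_cast at l3 ⊢
  linear_combination l3

/-- Reflection through the mean preserves `P` and changes the sign of the cubic integrand. -/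
theorem centralMoment₃_eq_zero_of_symmetric {d : ℕ} (P : Measure (Euc d))
    (h : P.map (fun x => WithLp.toLp 2 (fun i => 2 * mean P i - x i)) = P) (i j k : Fin d) :
    centralMoment₃ P i j k = 0 := by
  have h1 : centralMoment₃ P i j k = -centralMoment₃ P i j k := by
    have hm : Measurable fun x : Euc d => (WithLp.toLp 2 fun i => 2 * mean P i - x i : Euc d) := by
      fun_prop
    have : centralMoment₃ P i j k = ∫ x, (x i - mean P i) * (x j - mean P j) * (x k - mean P k)
        ∂(P.map (fun x => WithLp.toLp 2 (fun i => 2 * mean P i - x i))) := by rw [h, centralMoment₃]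
    rw [integral_map hm.aemeasurable (by fun_prop)] at this
    nth_rw 1 [this]
    rw [centralMoment₃, ← integral_neg]
    congr 1
    ext x
    simp only
    ring
  linarith

/-! ### The pointwise expansion and its remainder. -/

/-- The leading part of the squared distance of characteristic functions, without its weight. -/
noncomputable def leadingPart {d : ℕ} (P Q : Measure (Euc d)) (ω : Euc d) : ℝ :=
  meanForm P Q ω ^ 2 + (3 * covForm P Q ω ^ 2 - meanForm P Q ω ^ 4 -
    4 * meanForm P Q ω * skewForm P Q ω) / 12

theorem meanForm_smul {d : ℕ} (P Q : Measure (Euc d)) (r : ℝ) (x : Euc d) :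
    meanForm P Q (r • x) = r * meanForm P Q x := by
  simp only [meanForm, PiLp.smul_apply, smul_eq_mul, Finset.mul_sum, mul_assoc]

theorem covForm_smul {d : ℕ} (P Q : Measure (Euc d)) (r : ℝ) (x : Euc d) :
    covForm P Q (r • x) = r ^ 2 * covForm P Q x := by
  simp only [covForm, PiLp.smul_apply, smul_eq_mul, Finset.mul_sum]
  refine Finset.sum_congr rfl fun i _ => Finset.sum_congr rfl fun j _ => by ring

theorem skewForm_smul {d : ℕ} (P Q : Measure (Euc d)) (r : ℝ) (x : Euc d) :
    skewForm P Q (r • x) = r ^ 3 * skewForm P Q x := by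
  simp only [skewForm, PiLp.smul_apply, smul_eq_mul, Finset.mul_sum]
  refine Finset.sum_congr rfl fun i _ => Finset.sum_congr rfl fun j _ =>
    Finset.sum_congr rfl fun k _ => by ring

section Assumptions

variable {d : ℕ} {H : Euc d → ℝ} {B : ℝ → ℝ} {b K lam : ℝ} {P Q : Measure (Euc d)}
  {U V : Euc d → ℂ}

theorem LeadingMomentAssumptions.norm_listDeriv_le
    (h : LeadingMomentAssumptions H B b K lam P Q U V) {l : List (Fin d)} (hl : l.length ≤ 5)
    {x : Euc d} (hx : ‖x‖ ≤ 1) :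
    ‖listDeriv (fun ω => Complex.exp (U ω - V ω)) l x‖ ≤ |B 1| := by
  have h1 := (enorm_listDeriv_le_normC5 h.contDiff_pos hl hx).trans
    (le_self_add.trans (h.bound 1 zero_le_one))
  rw [← ofReal_norm] at h1
  exact (ENNReal.ofReal_le_ofReal_iff (abs_nonneg _)).1
    (h1.trans (ENNReal.ofReal_le_ofReal (le_abs_self _)))

theorem LeadingMomentAssumptions.norm_add_inv_norm_le
    (h : LeadingMomentAssumptions H B b K lam P Q U V) {r : ℝ} {ω : Euc d} (hω : ‖ω‖ ≤ r) :
    ‖Complex.exp (U ω - V ω)‖ + ‖Complex.exp (U ω - V ω)‖⁻¹ ≤ B r := by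
  have h1 := (add_le_add (enorm_listDeriv_le_normC5 h.contDiff_pos (l := []) (by simp) hω)
    (enorm_listDeriv_le_normC5 h.contDiff_neg (l := []) (by simp) hω)).trans
    (h.bound r ((norm_nonneg ω).trans hω))
  simp only [listDeriv] at h1
  have hpos : 0 < ‖Complex.exp (U ω - V ω)‖ := norm_pos_iff.2 (Complex.exp_ne_zero _)
  rw [Complex.exp_neg, ← ofReal_norm, ← ofReal_norm, ← ENNReal.ofReal_add (norm_nonneg _)
    (norm_nonneg _), ENNReal.ofReal_le_ofReal_iff', norm_inv] at h1
  -- `ENNReal.ofReal` truncates at zero, which adds the alternative that the left side is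
  -- nonpositive; it is a sum of positive terms.
  rcases h1 with h1 | h1
  · exact h1
  · have := inv_pos.2 hpos
    linarith

/-- From `a + 1 / a ≥ 2`. This lower bound allows `B` to absorb constants. -/
theorem LeadingMomentAssumptions.two_le (h : LeadingMomentAssumptions H B b K lam P Q U V)
    (ω : Euc d) : 2 ≤ B ‖ω‖ := by
  refine le_trans ?_ (h.norm_add_inv_norm_le le_rfl (ω := ω))
  have hpos : 0 < ‖Complex.exp (U ω - V ω)‖ := norm_pos_iff.2 (Complex.exp_ne_zero _)
  set a := ‖Complex.exp (U ω - V ω)‖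
  have : a + a⁻¹ - 2 = (a - 1) ^ 2 * a⁻¹ := by field_simp; ring
  have : 0 ≤ (a - 1) ^ 2 * a⁻¹ := by positivity
  linarith

/-- Factoring out `e^V` leaves `|e^V|² |F - 1|²`, and `|e^V|² |F|` is `|e^((U + V) / 2)|²`. The
quotient on the right is `|2 sinh(W / 2)|²`. -/
theorem LeadingMomentAssumptions.norm_sub_sq_eq
    (h : LeadingMomentAssumptions H B b K lam P Q U V) (ω : Euc d) :
    ‖charFun P ω - charFun Q ω‖ ^ 2 = H (lam • ω) *
      (‖Complex.exp (U ω - V ω) - 1‖ ^ 2 / ‖Complex.exp (U ω - V ω)‖) := by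
  have h1 : Complex.exp (U ω) - Complex.exp (V ω) =
      Complex.exp (V ω) * (Complex.exp (U ω - V ω) - 1) := by
    rw [mul_sub, ← Complex.exp_add]; ring_nf
  have h2 : ‖Complex.exp ((U ω + V ω) / 2)‖ ^ 2 =
      ‖Complex.exp (V ω)‖ ^ 2 * ‖Complex.exp (U ω - V ω)‖ := by
    rw [← norm_pow, ← norm_pow, ← norm_mul, ← Complex.exp_nat_mul, ← Complex.exp_nat_mul,
      ← Complex.exp_add]
    congr 2
    push_cast
    ring
  have hpos : 0 < ‖Complex.exp (U ω - V ω)‖ := norm_pos_iff.2 (Complex.exp_ne_zero _)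
  rw [h.charFun_left, h.charFun_right, h1, ← h.decay, h2, norm_mul, mul_pow]
  field_simp

theorem LeadingMomentAssumptions.nonneg (h : LeadingMomentAssumptions H B b K lam P Q U V)
    (ω : Euc d) : 0 ≤ H (lam • ω) := by
  rw [← h.decay]; positivity

/-- The derivatives of `e^W` at the origin bound the cumulants along unit vectors. -/
theorem LeadingMomentAssumptions.cumulant_bounds [IsProbabilityMeasure P] [IsProbabilityMeasure Q]
    (hd : 1 < d) (h : LeadingMomentAssumptions H B b K lam P Q U V)
    (hP : MemLp (fun x : Euc d => x) 3 P) (hQ : MemLp (fun x : Euc d => x) 3 Q) {A : ℝ}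
    (hA : A = d ^ 4 * |B 1| + 1) {θ : Euc d} (hθ : ‖θ‖ = 1) :
    |meanForm P Q θ| ≤ A ∧ |covForm P Q θ| ≤ A + A ^ 2 ∧
    |skewForm P Q θ| ≤ A + A ^ 3 + 3 * A * (A + A ^ 2) ∧
    ∀ t ∈ Set.Icc (0 : ℝ) 1, ‖Complex.exp (U (t • θ) - V (t • θ)) -
      (1 + t * (Complex.I * meanForm P Q θ) +
        t ^ 2 / 2 * (-(meanForm P Q θ ^ 2 + covForm P Q θ)) +
        t ^ 3 / 6 * (-(Complex.I * (meanForm P Q θ ^ 3 +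
      3 * meanForm P Q θ * covForm P Q θ + skewForm P Q θ))))‖ ≤ A * t ^ 4 := by
  let F : ℝ → ℂ := fun t => Complex.exp (U (t • θ) - V (t • θ))
  have hF : ContDiff ℝ 5 F := h.contDiff_pos.comp ((contDiff_smul_line θ).of_le le_top)
  -- Orders one to three control the cumulants, order four the Taylor remainder. The factor `d ^ k`
  -- counts words of length `k`.
  have hder : ∀ k ≤ 4, ∀ t : ℝ, |t| ≤ 1 → ‖iteratedDeriv k F t‖ ≤ A := by
    intro k hk t ht
    have := norm_iteratedDeriv_line_le (n := 5) h.contDiff_pos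
      (fun l hl x hx => h.norm_listDeriv_le hl hx) hθ.le k [] (by simp; omega) ht
    refine this.trans ?_
    rw [hA]
    have h1 : (1 : ℝ) ≤ d := by exact_mod_cast hd.le
    have h2 : (d : ℝ) ^ k ≤ d ^ 4 := pow_le_pow_right₀ h1 hk
    have h3 : (d : ℝ) ^ k * |B 1| ≤ d ^ 4 * |B 1| := by gcongr
    linarith
  obtain ⟨e0, e1, e2, e3⟩ := iteratedDeriv_quotient_line hP hQ θ (F := F)
    (hF.of_le (by norm_num)) (fun t => by
      rw [h.charFun_left, h.charFun_right, ← Complex.exp_add, sub_add_cancel])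
  have b1 := hder 1 (by norm_num) 0 (by simp)
  have b2 := hder 2 (by norm_num) 0 (by simp)
  have b3 := hder 3 (by norm_num) 0 (by simp)
  have htay := fun t ht => norm_sub_cubic_taylor_le hF (hder 4 le_rfl) (t := t) ht
  simp only [e0, e1, e2, e3] at htay
  rw [e1, norm_mul, Complex.norm_I, one_mul, Complex.norm_real, Real.norm_eq_abs] at b1
  rw [e2, norm_neg, ← Complex.ofReal_pow, ← Complex.ofReal_add, Complex.norm_real,
    Real.norm_eq_abs] at b2
  rw [e3, norm_neg, norm_mul, Complex.norm_I, one_mul] at b3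
  norm_cast at b3
  rw [Real.norm_eq_abs] at b3
  set μ := meanForm P Q θ
  set Δ := covForm P Q θ
  set κ := skewForm P Q θ
  have hA0 : 0 ≤ A := (abs_nonneg _).trans b1
  -- The derivatives bound `μ`, `μ² + Δ` and `μ³ + 3μΔ + κ`; the cumulants are recovered one after
  -- another.
  have c1 : |μ ^ 2| ≤ A ^ 2 := by rw [abs_pow]; gcongr
  have c2 : |Δ| ≤ A + A ^ 2 := by
    have := abs_sub (μ ^ 2 + Δ) (μ ^ 2)
    rw [add_sub_cancel_left] at this
    linarith
  refine ⟨b1, c2, ?_, htay⟩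
  have c3 : |μ ^ 3| ≤ A ^ 3 := by rw [abs_pow]; gcongr
  have c4 : |3 * μ * Δ| ≤ 3 * A * (A + A ^ 2) := by
    rw [abs_mul, abs_mul, abs_of_pos (three_pos : (0 : ℝ) < 3)]
    gcongr
  have i1 := abs_sub (μ ^ 3 + 3 * μ * Δ + κ) (μ ^ 3 + 3 * μ * Δ)
  rw [add_sub_cancel_left] at i1
  have i2 := abs_add_le (μ ^ 3) (3 * μ * Δ)
  linarith

end Assumptions

theorem abs_quartic_le {M μ Δ κ r : ℝ} (hμM : |μ| ≤ M) (hΔM : |Δ| ≤ M) (hκM : |κ| ≤ M)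
    (hM0 : 0 ≤ M) (hr1 : 1 ≤ r) :
    |μ ^ 2 * r ^ 2 + (3 * Δ ^ 2 - μ ^ 4 - 4 * μ * κ) / 12 * r ^ 4| ≤
      (8 * M ^ 2 + M ^ 4) * r ^ 5 := by
  have i1 : |μ ^ 2 * r ^ 2| ≤ M ^ 2 * r ^ 5 := by
    rw [abs_mul, abs_pow, abs_of_nonneg (by positivity : 0 ≤ r ^ 2)]
    gcongr
    norm_num
  have i2 : |(3 * Δ ^ 2 - μ ^ 4 - 4 * μ * κ) / 12| ≤ 7 * M ^ 2 + M ^ 4 := by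
    have j1 : |3 * Δ ^ 2| ≤ 3 * M ^ 2 := by
      rw [abs_mul, abs_pow, abs_of_pos (three_pos : (0 : ℝ) < 3)]
      gcongr
    have j2 : |μ ^ 4| ≤ M ^ 4 := by rw [abs_pow]; gcongr
    have j3 : |4 * μ * κ| ≤ 4 * M * M := by
      rw [abs_mul, abs_mul, abs_of_pos (four_pos : (0 : ℝ) < 4)]
      gcongr
    have j4 := abs_sub (3 * Δ ^ 2 - μ ^ 4) (4 * μ * κ)
    have j5 := abs_sub (3 * Δ ^ 2) (μ ^ 4)
    rw [abs_div, abs_of_pos (by norm_num : (0 : ℝ) < 12), div_le_iff₀ (by norm_num)]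
    have : 0 ≤ M ^ 2 := by positivity
    have : 0 ≤ M ^ 4 := by positivity
    linarith [pow_two M]
  have i3 : |(3 * Δ ^ 2 - μ ^ 4 - 4 * μ * κ) / 12 * r ^ 4| ≤ (7 * M ^ 2 + M ^ 4) * r ^ 5 := by
    rw [abs_mul, abs_of_nonneg (by positivity : 0 ≤ r ^ 4)]
    gcongr
    norm_num
  have := abs_add_le (μ ^ 2 * r ^ 2) ((3 * Δ ^ 2 - μ ^ 4 - 4 * μ * κ) / 12 * r ^ 4)
  linarith

/-- The remainder of the expansion, pointwise in `ω`. -/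
theorem exists_remainder_bound {d : ℕ} (hd : 1 < d) (B : ℝ → ℝ) : ∃ C : ℝ, 0 ≤ C ∧
    ∀ (H : Euc d → ℝ) (b K lam : ℝ) (P Q : Measure (Euc d)) [IsProbabilityMeasure P]
      [IsProbabilityMeasure Q] (U V : Euc d → ℂ),
      MemLp (fun x : Euc d => x) 3 P → MemLp (fun x : Euc d => x) 3 Q →
      LeadingMomentAssumptions H B b K lam P Q U V → ∀ ω : Euc d, ω ≠ 0 →
      |‖charFun P ω - charFun Q ω‖ ^ 2 - H (lam • ω) * leadingPart P Q ω| ≤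
        C * (H (lam • ω) * (‖ω‖ ^ 5 * B ‖ω‖)) := by
  set A : ℝ := d ^ 4 * |B 1| + 1 with hA
  have hA1 : 1 ≤ A := by
    have : 0 ≤ (d : ℝ) ^ 4 * |B 1| := by positivity
    linarith
  have hAB : |B 1| ≤ A := by
    have h1 : (1 : ℝ) ≤ d ^ 4 := one_le_pow₀ (by exact_mod_cast hd.le)
    have : |B 1| ≤ (d : ℝ) ^ 4 * |B 1| := le_mul_of_one_le_left (abs_nonneg _) h1
    linarith
  have hA0 : 0 ≤ A := by linarith
  set M : ℝ := A + (A + A ^ 2) + (A + A ^ 3 + 3 * A * (A + A ^ 2)) with hM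
  have p1 : 0 ≤ A + A ^ 2 := by positivity
  have p2 : 0 ≤ A + A ^ 3 + 3 * A * (A + A ^ 2) := by positivity
  have hAM : A ≤ M := by linarith
  have hM0 : 0 ≤ M := by linarith
  obtain ⟨C4, hC4, hexp⟩ := exists_bound_norm_sub_one_sq_div M (by linarith)
  -- `C4` serves `‖ω‖ ≤ 1`. For `‖ω‖ ≥ 1`, `2` bounds the quotient `|F - 1|² / |F|` and the last
  -- summand the leading part, both relative to `‖ω‖⁵ B(‖ω‖)`.
  refine ⟨C4 + 2 + (8 * M ^ 2 + M ^ 4), by positivity, ?_⟩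
  intro H b K lam P Q _ _ U V hP hQ h ω hω
  rw [h.norm_sub_sq_eq, ← mul_sub, abs_mul, abs_of_nonneg (h.nonneg ω)]
  rw [mul_left_comm]
  refine mul_le_mul_of_nonneg_left ?_ (h.nonneg ω)
  set r := ‖ω‖ with hr
  have hr0 : 0 < r := norm_pos_iff.2 hω
  obtain ⟨θ, hθ, hωθ⟩ : ∃ θ : Euc d, ‖θ‖ = 1 ∧ ω = r • θ := by
    refine ⟨r⁻¹ • ω, ?_, ?_⟩
    · rw [norm_smul, norm_inv, Real.norm_of_nonneg hr0.le, ← hr, inv_mul_cancel₀ hr0.ne']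
    · rw [smul_smul, mul_inv_cancel₀ hr0.ne', one_smul]
  obtain ⟨hμ, hΔ, hκ, htay⟩ := h.cumulant_bounds hd hP hQ hA hθ
  have hS : leadingPart P Q ω = meanForm P Q θ ^ 2 * r ^ 2 + (3 * covForm P Q θ ^ 2 -
      meanForm P Q θ ^ 4 - 4 * meanForm P Q θ * skewForm P Q θ) / 12 * r ^ 4 := by
    rw [leadingPart, hωθ, meanForm_smul, covForm_smul, skewForm_smul]
    ring
  have hB := h.two_le ω
  rw [← hr] at hB
  set F := Complex.exp (U ω - V ω) with hFdef
  have hFpos : 0 < ‖F‖ := norm_pos_iff.2 (Complex.exp_ne_zero _)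
  set μ := meanForm P Q θ
  set Δ := covForm P Q θ
  set κ := skewForm P Q θ
  have hμM : |μ| ≤ M := by linarith
  have hΔM : |Δ| ≤ M := by linarith
  have hκM : |κ| ≤ M := by linarith
  rw [hS]
  rcases le_total r 1 with hr1 | hr1
  · have ht := htay r ⟨hr0.le, hr1⟩
    rw [← hωθ, ← hFdef] at ht
    set T : ℂ := 1 + r * (Complex.I * μ) + r ^ 2 / 2 * (-(μ ^ 2 + Δ)) +
      r ^ 3 / 6 * (-(Complex.I * (μ ^ 3 + 3 * μ * Δ + κ))) with hT
    have hrC : (r : ℂ) ≠ 0 := by exact_mod_cast hr0.ne'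
    -- The Taylor remainder divided by `r ^ 4` plays the role of `ε` in the algebraic expansion.
    have hε : ‖(F - T) / r ^ 4‖ ≤ M := by
      rw [norm_div, norm_pow, Complex.norm_real, Real.norm_of_nonneg hr0.le,
        div_le_iff₀ (by positivity)]
      refine ht.trans ?_
      gcongr
    have hinv : ‖F‖⁻¹ ≤ M := by
      have := h.norm_add_inv_norm_le hr1 (ω := ω)
      linarith [le_abs_self (B 1), norm_nonneg F]
    have := hexp μ Δ κ r ((F - T) / r ^ 4) F hμM hΔM hκM hr0.le hr1 hε
      (Complex.exp_ne_zero _) hinv (by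
        rw [div_mul_cancel₀ _ (pow_ne_zero 4 hrC), hT]
        ring)
    refine this.trans ?_
    calc C4 * r ^ 5 = C4 * (r ^ 5 * 1) := by ring
      _ ≤ (C4 + 2 + (8 * M ^ 2 + M ^ 4)) * (r ^ 5 * B r) := by
        have : 0 ≤ 8 * M ^ 2 + M ^ 4 := by positivity
        gcongr <;> linarith
  · have hle := h.norm_add_inv_norm_le le_rfl (ω := ω)
    rw [← hFdef, ← hr] at hle
    have h1r5 : 1 ≤ r ^ 5 := one_le_pow₀ hr1
    have hN : ‖F - 1‖ ^ 2 / ‖F‖ ≤ 2 * (r ^ 5 * B r) := by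
      have i1 : ‖F - 1‖ ≤ ‖F‖ + 1 := by simpa using norm_sub_le F 1
      have i2 : ‖F - 1‖ ^ 2 / ‖F‖ ≤ (‖F‖ + 1) ^ 2 / ‖F‖ := by gcongr
      have i3 : (‖F‖ + 1) ^ 2 / ‖F‖ = ‖F‖ + 2 + ‖F‖⁻¹ := by field_simp; ring
      have i4 : 1 * B r ≤ r ^ 5 * B r := by gcongr
      linarith
    have hSb : |μ ^ 2 * r ^ 2 + (3 * Δ ^ 2 - μ ^ 4 - 4 * μ * κ) / 12 * r ^ 4| ≤
        (8 * M ^ 2 + M ^ 4) * (r ^ 5 * B r) := by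
      refine (abs_quartic_le hμM hΔM hκM hM0 hr1).trans ?_
      have : 0 ≤ 8 * M ^ 2 + M ^ 4 := by positivity
      have : r ^ 5 * 1 ≤ r ^ 5 * B r := by gcongr; linarith
      gcongr
      linarith
    have i5 := abs_sub (‖F - 1‖ ^ 2 / ‖F‖)
      (μ ^ 2 * r ^ 2 + (3 * Δ ^ 2 - μ ^ 4 - 4 * μ * κ) / 12 * r ^ 4)
    rw [abs_of_nonneg (by positivity : 0 ≤ ‖F - 1‖ ^ 2 / ‖F‖)] at i5
    have i6 : 0 ≤ C4 * (r ^ 5 * B r) := by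
      have : 0 ≤ B r := by linarith
      positivity
    linarith

/-! ### Spherical integrals of the quadratic and quartic forms. -/

theorem integral_sphere_quadratic {d : ℕ} (hd : 1 < d) (T : Fin d → Fin d → ℝ) :
    ∫ θ, ∑ i, ∑ j, T i j * ((θ : Euc d) i * (θ : Euc d) j) ∂(surfaceMeasure d) =
      sphereArea d / d * ∑ i, T i i := by
  have hi : ∀ i j, Integrable (fun θ : Metric.sphere (0 : Euc d) 1 =>
      T i j * ((θ : Euc d) i * (θ : Euc d) j)) (surfaceMeasure d) := fun i j =>
    integrable_sphere (p := fun x => T i j * (x i * x j)) (by fun_prop)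
  rw [integral_finsetSum _ fun i _ => integrable_finsetSum _ fun j _ => hi i j, Finset.mul_sum]
  refine Finset.sum_congr rfl fun i _ => ?_
  rw [integral_finsetSum _ fun j _ => hi i j]
  simp only [integral_const_mul, sphere_second_moment hd]
  simp [mul_comm]

theorem integral_sphere_quartic {d : ℕ} (hd : 1 < d) (T : Fin d → Fin d → Fin d → Fin d → ℝ) :
    ∫ θ, ∑ i, ∑ j, ∑ k, ∑ l, T i j k l *
      ((θ : Euc d) i * ((θ : Euc d) j * (θ : Euc d) k * (θ : Euc d) l)) ∂(surfaceMeasure d) =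
      sphereArea d / (d * (d + 2)) * ∑ i, ∑ j, (T i i j j + T i j i j + T i j j i) := by
  have hi : ∀ i j k l, Integrable (fun θ : Metric.sphere (0 : Euc d) 1 => T i j k l *
      ((θ : Euc d) i * ((θ : Euc d) j * (θ : Euc d) k * (θ : Euc d) l))) (surfaceMeasure d) :=
    fun i j k l => integrable_sphere (p := fun x => T i j k l * (x i * (x j * x k * x l)))
      (by fun_prop)
  rw [integral_finsetSum _ fun i _ => integrable_finsetSum _ fun j _ =>
    integrable_finsetSum _ fun k _ => integrable_finsetSum _ fun l _ => hi i j k l, Finset.mul_sum]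
  refine Finset.sum_congr rfl fun i _ => ?_
  rw [integral_finsetSum _ fun j _ => integrable_finsetSum _ fun k _ =>
    integrable_finsetSum _ fun l _ => hi i j k l]
  have h1 : ∀ j, ∫ θ, ∑ k, ∑ l, T i j k l *
      ((θ : Euc d) i * ((θ : Euc d) j * (θ : Euc d) k * (θ : Euc d) l)) ∂(surfaceMeasure d) =
      sphereArea d / (d * (d + 2)) * ((∑ k, if i = j then T i j k k else 0) +
        T i j i j + T i j j i) := by
    intro j
    rw [integral_finsetSum _ fun k _ => integrable_finsetSum _ fun l _ => hi i j k l]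
    have h2 : ∀ k, ∫ θ, ∑ l, T i j k l *
        ((θ : Euc d) i * ((θ : Euc d) j * (θ : Euc d) k * (θ : Euc d) l)) ∂(surfaceMeasure d) =
        sphereArea d / (d * (d + 2)) * ((if i = j then T i j k k else 0) +
          (if i = k then T i j k j else 0) + (if j = k then T i j k i else 0)) := by
      intro k
      rw [integral_finsetSum _ fun l _ => hi i j k l]
      simp only [integral_const_mul, sphere_fourth_moment hd]
      simp only [mul_comm _ (sphereArea d / _), mul_left_comm _ (sphereArea d / _),
        ← Finset.mul_sum]
      congr 1
      simp [mul_add, Finset.sum_add_distrib]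
    simp only [h2, ← Finset.mul_sum, Finset.sum_add_distrib]
    simp
  simp only [h1, ← Finset.mul_sum, Finset.sum_add_distrib]
  congr 3
  rw [Finset.sum_comm]
  simp

section Radial

variable {d : ℕ} (P Q : Measure (Euc d))

theorem covDiff_symm (i j : Fin d) : covDiff P Q i j = covDiff P Q j i := by
  simp only [covDiff, Matrix.of_apply, cov, mul_comm]

theorem skewDiff_swap_left (i j k : Fin d) : skewDiff P Q i j k = skewDiff P Q j i k := by
  have : ∀ (R : Measure (Euc d)), centralMoment₃ R i j k = centralMoment₃ R j i k := fun R => by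
    unfold centralMoment₃
    congr 1; ext x; ring
  simp only [skewDiff, this]

theorem skewDiff_swap_right (i j k : Fin d) : skewDiff P Q i j k = skewDiff P Q i k j := by
  have : ∀ (R : Measure (Euc d)), centralMoment₃ R i j k = centralMoment₃ R i k j := fun R => by
    unfold centralMoment₃
    congr 1; ext x; ring
  simp only [skewDiff, this]

theorem integral_sphere_meanForm_sq (hd : 1 < d) :
    ∫ θ, meanForm P Q θ ^ 2 ∂(surfaceMeasure d) = sphereArea d / d * meanDiffSq P Q := by
  have h : ∀ x : Euc d, meanForm P Q x ^ 2 =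
      ∑ i, ∑ j, meanDiff P Q i * meanDiff P Q j * (x i * x j) := fun x => by
    rw [meanForm, pow_two, Finset.sum_mul_sum]
    exact Finset.sum_congr rfl fun i _ => Finset.sum_congr rfl fun j _ => by ring
  simp only [h]
  rw [integral_sphere_quadratic hd, meanDiffSq]
  simp only [pow_two]

/-- Summed over the three pairings, `Δ ⊗ Δ` gives `Trace(Δ)² + 2 ‖Δ‖_F²`, while `μ ⊗ μ ⊗ μ ⊗ μ` and
`μ ⊗ κ` give `3 ‖μ‖⁴` and `3 β · μ` by the symmetry of `κ`. This accounts for the common factor `3`.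
-/
theorem integral_sphere_quartic_form (hd : 1 < d) :
    ∫ θ, (3 * covForm P Q θ ^ 2 - meanForm P Q θ ^ 4 - 4 * meanForm P Q θ * skewForm P Q θ)
      ∂(surfaceMeasure d) = sphereArea d / (d * (d + 2)) * (3 *
        (2 * covDiffFrobSq P Q + (covDiff P Q).trace ^ 2 - meanDiffSq P Q ^ 2
          - 4 * skewMean P Q)) := by
  have h1 : ∀ x : Euc d, covForm P Q x ^ 2 = ∑ i, ∑ j, ∑ k, ∑ l,
      covDiff P Q i j * covDiff P Q k l * (x i * (x j * x k * x l)) := fun x => by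
    simp only [covForm, pow_two, Finset.sum_mul]
    refine Finset.sum_congr rfl fun i _ => Finset.sum_congr rfl fun j _ => ?_
    simp only [Finset.mul_sum]
    exact Finset.sum_congr rfl fun k _ => Finset.sum_congr rfl fun l _ => by ring
  have h2 : ∀ x : Euc d, meanForm P Q x ^ 4 = ∑ i, ∑ j, ∑ k, ∑ l,
      meanDiff P Q i * meanDiff P Q j * meanDiff P Q k * meanDiff P Q l *
        (x i * (x j * x k * x l)) := fun x => by
    rw [show meanForm P Q x ^ 4 =
      meanForm P Q x * (meanForm P Q x * (meanForm P Q x * meanForm P Q x)) by ring]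
    simp only [meanForm, Finset.sum_mul]
    refine Finset.sum_congr rfl fun i _ => ?_
    simp only [Finset.mul_sum]
    refine Finset.sum_congr rfl fun j _ => ?_
    exact Finset.sum_congr rfl fun k _ => Finset.sum_congr rfl fun l _ => by ring
  have h3 : ∀ x : Euc d, meanForm P Q x * skewForm P Q x = ∑ i, ∑ j, ∑ k, ∑ l,
      meanDiff P Q i * skewDiff P Q j k l * (x i * (x j * x k * x l)) := fun x => by
    simp only [meanForm, skewForm, Finset.sum_mul]
    refine Finset.sum_congr rfl fun i _ => ?_
    simp only [Finset.mul_sum]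
    refine Finset.sum_congr rfl fun j _ => ?_
    exact Finset.sum_congr rfl fun k _ => Finset.sum_congr rfl fun l _ => by ring
  have h : ∀ x : Euc d,
      3 * covForm P Q x ^ 2 - meanForm P Q x ^ 4 - 4 * meanForm P Q x * skewForm P Q x =
      ∑ i, ∑ j, ∑ k, ∑ l, (3 * (covDiff P Q i j * covDiff P Q k l) -
        meanDiff P Q i * meanDiff P Q j * meanDiff P Q k * meanDiff P Q l -
        4 * (meanDiff P Q i * skewDiff P Q j k l)) * (x i * (x j * x k * x l)) := fun x => by
    rw [mul_assoc 4, h1, h2, h3]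
    simp only [Finset.mul_sum, ← Finset.sum_sub_distrib]
    refine Finset.sum_congr rfl fun i _ => Finset.sum_congr rfl fun j _ => ?_
    exact Finset.sum_congr rfl fun k _ => Finset.sum_congr rfl fun l _ => by ring
  simp only [h]
  rw [integral_sphere_quartic hd]
  congr 1
  have e1 : (covDiff P Q).trace ^ 2 = ∑ i, ∑ j, covDiff P Q i i * covDiff P Q j j := by
    rw [Matrix.trace, pow_two, Finset.sum_mul_sum]
    rfl
  have e2 : meanDiffSq P Q ^ 2 = ∑ i, ∑ j, meanDiff P Q i ^ 2 * meanDiff P Q j ^ 2 := by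
    rw [meanDiffSq, pow_two, Finset.sum_mul_sum]
  have e3 : skewMean P Q = ∑ i, ∑ j, meanDiff P Q i * skewDiff P Q i j j := by
    rw [skewMean, Finset.sum_comm]
    refine Finset.sum_congr rfl fun i _ => Finset.sum_congr rfl fun j _ => ?_
    rw [skewDiff_swap_left P Q i j j, skewDiff_swap_right P Q j i j, mul_comm]
  rw [e1, e2, e3, covDiffFrobSq]
  simp only [Finset.mul_sum, ← Finset.sum_sub_distrib, ← Finset.sum_add_distrib]
  refine Finset.sum_congr rfl fun i _ => Finset.sum_congr rfl fun j _ => ?_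
  rw [covDiff_symm P Q j i, skewDiff_swap_left P Q j i j, skewDiff_swap_right P Q j j i,
    skewDiff_swap_left P Q j i j]
  ring

end Radial

/-! ### Integrability of the weight, scaling, and integration of the expansion. -/

theorem exists_bound_of_homogeneous {d : ℕ} {p : Euc d → ℝ} (hp : Continuous p) {k : ℕ}
    (hk : k ≠ 0) (hom : ∀ (r : ℝ) x, p (r • x) = r ^ k * p x) : ∃ C, ∀ x, |p x| ≤ C * ‖x‖ ^ k := by
  obtain ⟨C, hC⟩ := (isCompact_sphere (0 : Euc d) 1).exists_bound_of_continuousOn hp.continuousOn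
  refine ⟨C, fun x => ?_⟩
  rcases eq_or_ne x 0 with rfl | hx
  · have := hom 0 0
    simp [hk] at this
    simp [this, hk]
  · have hn : ‖x‖ ≠ 0 := norm_ne_zero_iff.2 hx
    have h1 := hC (‖x‖⁻¹ • x) (by simp [norm_smul, hn])
    have h2 : x = ‖x‖ • ‖x‖⁻¹ • x := by rw [smul_smul, mul_inv_cancel₀ hn, one_smul]
    rw [h2, hom, abs_mul, abs_of_nonneg (by positivity), ← h2, mul_comm]
    gcongr
    exact h1

theorem continuous_meanForm {d : ℕ} (P Q : Measure (Euc d)) : Continuous (meanForm P Q) := by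
  unfold meanForm; fun_prop

theorem continuous_covForm {d : ℕ} (P Q : Measure (Euc d)) : Continuous (covForm P Q) := by
  unfold covForm; fun_prop

theorem continuous_skewForm {d : ℕ} (P Q : Measure (Euc d)) : Continuous (skewForm P Q) := by
  unfold skewForm; fun_prop

section Assumptions

variable {d : ℕ} {H : Euc d → ℝ} {B : ℝ → ℝ} {b K lam : ℝ} {P Q : Measure (Euc d)}
  {U V : Euc d → ℂ}

/-- `H` is an arbitrary function; this formula makes `H(lam ω)` measurable in `ω` and bounded by
`1`. -/
theorem LeadingMomentAssumptions.weight_eq (h : LeadingMomentAssumptions H B b K lam P Q U V)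
    (ω : Euc d) : H (lam • ω) = ‖charFun P ω‖ * ‖charFun Q ω‖ := by
  rw [← h.decay, h.charFun_left, h.charFun_right, ← norm_pow, ← norm_mul, ← Complex.exp_nat_mul,
    ← Complex.exp_add]
  congr 2
  push_cast
  ring

/-- In the unit ball the weight is at most `1`, and polar coordinates leave `r ^ (k - 2)`, which is
integrable as `k ≥ 2`. Outside, `‖ω‖ ^ k ≤ ‖ω‖ ^ 5 B(‖ω‖)`, and the growth hypothesis dominates. -/
theorem LeadingMomentAssumptions.integrable_weight [IsProbabilityMeasure P]
    [IsProbabilityMeasure Q] (hd : 1 < d) (h : LeadingMomentAssumptions H B b K lam P Q U V)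
    {k : ℕ} (hk2 : 2 ≤ k) (hk5 : k ≤ 5) :
    Integrable fun ω : Euc d => H (lam • ω) * ‖ω‖ ^ k / ‖ω‖ ^ (d + 1) := by
  have := nontrivial_euc hd
  have hball : IntegrableOn (fun ω : Euc d => ‖ω‖ ^ k / ‖ω‖ ^ (d + 1)) (Metric.ball 0 1) := by
    refine (integrableOn_fun_norm_addHaar (volume : Measure (Euc d))
      (f := fun r => r ^ k / r ^ (d + 1)) (r := 1)).2 ?_
    rw [finrank_euc]
    have h1 : IntegrableOn (fun y : ℝ => y ^ (k - 2)) (Set.Ioo 0 1) :=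
      (Continuous.integrableOn_Icc (by fun_prop)).mono_set Set.Ioo_subset_Icc_self
    refine h1.congr_fun (fun y hy => ?_) measurableSet_Ioo
    have hy0 : y ≠ 0 := hy.1.ne'
    rw [smul_eq_mul, mul_div_assoc', eq_div_iff (by positivity), ← pow_add, ← pow_add]
    congr 1
    omega
  have hball' := (integrable_indicator_iff Metric.isOpen_ball.measurableSet).2 hball
  refine (h.growth_integrable.add hball').mono' ?_ ?_
  · simp only [h.weight_eq]
    exact (show Measurable _ by fun_prop).aestronglyMeasurable
  · filter_upwards [Measure.ae_ne volume (0 : Euc d)] with ω hω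
    have hω' : 0 < ‖ω‖ := norm_pos_iff.2 hω
    have hB := h.two_le ω
    have hH := h.nonneg ω
    have hH1 : H (lam • ω) ≤ 1 := by
      rw [h.weight_eq]
      exact mul_le_one₀ (norm_charFun_le_one ω) (norm_nonneg _) (norm_charFun_le_one ω)
    have hterm : 0 ≤ H (lam • ω) / ‖ω‖ ^ (d + 1) * ‖ω‖ ^ 5 * B ‖ω‖ := by
      have : 0 ≤ B ‖ω‖ := by linarith
      positivity
    rw [Real.norm_of_nonneg (by positivity), Pi.add_apply]
    by_cases hmem : ω ∈ Metric.ball (0 : Euc d) 1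
    · rw [Set.indicator_of_mem hmem]
      have : H (lam • ω) * ‖ω‖ ^ k / ‖ω‖ ^ (d + 1) ≤ 1 * ‖ω‖ ^ k / ‖ω‖ ^ (d + 1) := by gcongr
      rw [one_mul] at this
      linarith
    · rw [Set.indicator_of_notMem hmem, add_zero]
      have h1 : 1 ≤ ‖ω‖ := by simpa using hmem
      calc H (lam • ω) * ‖ω‖ ^ k / ‖ω‖ ^ (d + 1)
          ≤ H (lam • ω) * ‖ω‖ ^ 5 / ‖ω‖ ^ (d + 1) := by gcongr
        _ = H (lam • ω) / ‖ω‖ ^ (d + 1) * ‖ω‖ ^ 5 * 1 := by ring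
        _ ≤ H (lam • ω) / ‖ω‖ ^ (d + 1) * ‖ω‖ ^ 5 * B ‖ω‖ := by gcongr; linarith

/-- Polar coordinates for the weighted integral of a homogeneous function. -/
theorem LeadingMomentAssumptions.integral_homogeneous [IsProbabilityMeasure P]
    [IsProbabilityMeasure Q] (hd : 1 < d) (hlam : 0 < lam)
    (h : LeadingMomentAssumptions H B b K lam P Q U V) {k : ℕ} (hk : k ≤ 3) {p : Euc d → ℝ}
    (hp : Continuous p) (hom : ∀ (r : ℝ) x, p (r • x) = r ^ (k + 2) * p x) :
    Integrable (fun ω : Euc d => H (lam • ω) * p ω / ‖ω‖ ^ (d + 1)) ∧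
    IntegrableOn (fun r : ℝ => r ^ k * ∫ θ, H (r • (θ : Euc d)) * p θ ∂(surfaceMeasure d))
      (Set.Ioi 0) ∧
    ∫ ω : Euc d, H (lam • ω) * p ω / ‖ω‖ ^ (d + 1) = 1 / lam ^ (k + 1) *
      ∫ r in Set.Ioi (0 : ℝ), r ^ k *
        ∫ θ, H (r • (θ : Euc d)) * p θ ∂(surfaceMeasure d) := by
  obtain ⟨C, hC⟩ := exists_bound_of_homogeneous hp (by omega) hom
  have hint : Integrable fun ω : Euc d => H (lam • ω) * p ω / ‖ω‖ ^ (d + 1) := by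
    refine ((h.integrable_weight hd (k := k + 2) (by omega) (by omega)).const_mul C).mono' ?_
      (.of_forall fun ω => ?_)
    · simp only [h.weight_eq]
      exact (show Measurable _ by fun_prop).aestronglyMeasurable
    · have hH := h.nonneg ω
      rw [Real.norm_eq_abs, abs_div, abs_mul, abs_of_nonneg hH,
        abs_of_nonneg (by positivity : 0 ≤ ‖ω‖ ^ (d + 1))]
      calc H (lam • ω) * |p ω| / ‖ω‖ ^ (d + 1)
          ≤ H (lam • ω) * (C * ‖ω‖ ^ (k + 2)) / ‖ω‖ ^ (d + 1) := by gcongr; exact hC ω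
        _ = _ := by ring
  obtain ⟨i1, i2⟩ := integral_polar hd hint
  let Φ : ℝ → ℝ := fun r => r ^ k * ∫ θ, H (r • (θ : Euc d)) * p θ ∂(surfaceMeasure d)
  -- The powers of `r` combine as `(d - 1) + (k + 2) - (d + 1) = k`. Writing `r ^ k` as `(lam r) ^ k
  -- / lam ^ k` gives `lam ^ (-k)`; the change of variables supplies one more factor `1 / lam`.
  have heq : ∀ r ∈ Set.Ioi (0 : ℝ), r ^ (d - 1) *
      ∫ θ, H (lam • r • (θ : Euc d)) * p (r • (θ : Euc d)) / ‖r • (θ : Euc d)‖ ^ (d + 1)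
        ∂(surfaceMeasure d) = 1 / lam ^ k * Φ (lam * r) := by
    intro r hr
    have hr0 : (0 : ℝ) < r := hr
    have : ∀ θ : Metric.sphere (0 : Euc d) 1, H (lam • r • (θ : Euc d)) * p (r • (θ : Euc d)) /
        ‖r • (θ : Euc d)‖ ^ (d + 1) =
        r ^ (k + 2) / r ^ (d + 1) * (H ((lam * r) • (θ : Euc d)) * p θ) := fun θ => by
      rw [hom, norm_smul, norm_eq_of_mem_sphere θ, mul_one, Real.norm_of_nonneg hr0.le, smul_smul]
      ring
    simp only [this]
    rw [integral_const_mul, ← mul_assoc]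
    have e : r ^ (d - 1) * (r ^ (k + 2) / r ^ (d + 1)) = r ^ k := by
      rw [mul_div_assoc', div_eq_iff (by positivity), ← pow_add, ← pow_add]
      congr 1
      omega
    rw [e]
    simp only [Φ, mul_pow]
    field_simp
  have i1' : IntegrableOn (fun r => Φ (lam * r)) (Set.Ioi 0) := by
    have := (i1.congr_fun heq measurableSet_Ioi).const_mul (lam ^ k)
    refine this.congr (.of_forall fun r => ?_)
    simp only
    field_simp
  refine ⟨hint, ?_, ?_⟩
  · have := (integrableOn_Ioi_comp_mul_left_iff Φ 0 hlam).1 i1'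
    rwa [mul_zero] at this
  · rw [i2, setIntegral_congr_fun measurableSet_Ioi heq, integral_const_mul,
      integral_comp_mul_left_Ioi Φ 0 hlam, mul_zero, smul_eq_mul]
    simp only [Φ]
    field_simp
    ring

end Assumptions

section Assumptions

variable {d : ℕ} {H : Euc d → ℝ} {B : ℝ → ℝ} {b K lam : ℝ} {P Q : Measure (Euc d)}
  {U V : Euc d → ℂ}

theorem LeadingMomentAssumptions.integral_leadingPart [IsProbabilityMeasure P]
    [IsProbabilityMeasure Q] (hd : 1 < d) (hlam : 0 < lam)
    (h : LeadingMomentAssumptions H B b K lam P Q U V) :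
    Integrable (fun ω : Euc d => H (lam • ω) * leadingPart P Q ω / ‖ω‖ ^ (d + 1)) ∧
    IntegrableOn (firstSpherical H P Q) (Set.Ioi 0) ∧
    IntegrableOn (fun r => r ^ 2 * secondSpherical H P Q r) (Set.Ioi 0) ∧
    ∫ ω : Euc d, H (lam • ω) * leadingPart P Q ω / ‖ω‖ ^ (d + 1) =
      1 / lam * (∫ r in Set.Ioi (0 : ℝ), firstSpherical H P Q r) +
      1 / lam ^ 3 * (1 / 12) * ∫ r in Set.Ioi (0 : ℝ), r ^ 2 * secondSpherical H P Q r := by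
  have cm := continuous_meanForm P Q
  have cc := continuous_covForm P Q
  have cs := continuous_skewForm P Q
  obtain ⟨i1, j1, e1⟩ := h.integral_homogeneous hd hlam (k := 0) (by norm_num)
    (p := fun x => meanForm P Q x ^ 2) (by fun_prop) (fun r x => by rw [meanForm_smul]; ring)
  obtain ⟨i2, j2, e2⟩ := h.integral_homogeneous hd hlam (k := 2) (by norm_num)
    (p := fun x => 3 * covForm P Q x ^ 2 - meanForm P Q x ^ 4 -
      4 * meanForm P Q x * skewForm P Q x) (by fun_prop)
    (fun r x => by rw [meanForm_smul, covForm_smul, skewForm_smul]; ring)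
  have heq : ∀ ω : Euc d, H (lam • ω) * leadingPart P Q ω / ‖ω‖ ^ (d + 1) =
      H (lam • ω) * meanForm P Q ω ^ 2 / ‖ω‖ ^ (d + 1) + 1 / 12 *
      (H (lam • ω) * (3 * covForm P Q ω ^ 2 - meanForm P Q ω ^ 4 -
        4 * meanForm P Q ω * skewForm P Q ω) / ‖ω‖ ^ (d + 1)) := fun ω => by
    rw [leadingPart]; ring
  simp only [heq]
  simp only [pow_zero, one_mul, zero_add, pow_one] at j1 e1
  refine ⟨i1.add (i2.const_mul _), j1, j2, ?_⟩
  rw [integral_add i1 (i2.const_mul _), integral_const_mul, e1, e2]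
  simp only [firstSpherical, secondSpherical]
  ring

theorem LeadingMomentAssumptions.abs_remainder_le [IsProbabilityMeasure P]
    [IsProbabilityMeasure Q] (hd : 1 < d) (hlam : 0 < lam)
    (hP : MemLp (fun x : Euc d => x) 3 P) (hQ : MemLp (fun x : Euc d => x) 3 Q)
    (h : LeadingMomentAssumptions H B b K lam P Q U V) {C : ℝ} (hC : 0 ≤ C)
    (hbound : ∀ ω : Euc d, ω ≠ 0 →
      |‖charFun P ω - charFun Q ω‖ ^ 2 - H (lam • ω) * leadingPart P Q ω| ≤
        C * (H (lam • ω) * (‖ω‖ ^ 5 * B ‖ω‖))) :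
    |energyDistSq P Q - 1 / energyConst d *
      ∫ ω : Euc d, H (lam • ω) * leadingPart P Q ω / ‖ω‖ ^ (d + 1)| ≤
      1 / energyConst d * (C * (K * lam ^ (-(4 - b)))) := by
  have := nontrivial_euc hd
  have hc := energyConst_pos d
  obtain ⟨i1, e1⟩ := energyDistSq_eq hd P Q (hP.integrable (by norm_num))
    (hQ.integrable (by norm_num))
  obtain ⟨i2, -, -, -⟩ := h.integral_leadingPart hd hlam
  rw [e1, ← mul_sub, ← integral_sub i1 i2, abs_mul, abs_of_pos (by positivity)]
  refine mul_le_mul_of_nonneg_left ?_ (by positivity)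
  refine le_trans ?_ (mul_le_mul_of_nonneg_left h.growth hC)
  rw [← integral_const_mul, ← Real.norm_eq_abs]
  refine norm_integral_le_of_norm_le (h.growth_integrable.const_mul C) ?_
  filter_upwards [Measure.ae_ne volume (0 : Euc d)] with ω hω
  have hω' : 0 < ‖ω‖ := norm_pos_iff.2 hω
  rw [← sub_div, norm_div, Real.norm_eq_abs, Real.norm_of_nonneg (by positivity)]
  calc |‖charFun P ω - charFun Q ω‖ ^ 2 - H (lam • ω) * leadingPart P Q ω| / ‖ω‖ ^ (d + 1)
      ≤ C * (H (lam • ω) * (‖ω‖ ^ 5 * B ‖ω‖)) / ‖ω‖ ^ (d + 1) := by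
        gcongr
        exact hbound ω hω
    _ = _ := by ring

/-- The moment forms may vanish and then carry no information on `η`. The polar formula is applied
to `‖x‖ ^ (k + 2)` instead, whose spherical integral is a positive multiple of `η`. -/
theorem LeadingMomentAssumptions.integrableOn_radial [IsProbabilityMeasure P]
    [IsProbabilityMeasure Q] (hd : 1 < d) (hlam : 0 < lam)
    (h : LeadingMomentAssumptions H B b K lam P Q U V) {η : ℝ → ℝ} (hη : ∀ ω, H ω = η ‖ω‖) :
    IntegrableOn η (Set.Ioi 0) ∧ IntegrableOn (fun r => η r * r ^ 2) (Set.Ioi 0) := by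
  have hA := (sphereArea_pos hd).ne'
  -- Evenness is needed because homogeneity is required for negative scalars as well.
  have key : ∀ k : ℕ, k ≤ 3 → Even k → IntegrableOn (fun r => r ^ k * η r) (Set.Ioi 0) := by
    intro k hk heven
    obtain ⟨-, j, -⟩ := h.integral_homogeneous hd hlam hk (p := fun x => ‖x‖ ^ (k + 2))
      (by fun_prop) (fun r x => by
        rw [norm_smul, mul_pow, Real.norm_eq_abs, (heven.add even_two).pow_abs])
    have hj := j.mul_const (sphereArea d)⁻¹
    refine IntegrableOn.congr_fun hj (fun r hr => ?_) measurableSet_Ioi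
    have hr0 : (0 : ℝ) < r := hr
    have e : ∀ θ : Metric.sphere (0 : Euc d) 1, H (r • (θ : Euc d)) * ‖(θ : Euc d)‖ ^ (k + 2) =
        η r := fun θ => by
      rw [hη, norm_smul, norm_eq_of_mem_sphere θ, Real.norm_of_nonneg hr0.le]
      simp
    simp only [e, integral_const, smul_eq_mul]
    change r ^ k * (sphereArea d * η r) * _ = _
    field_simp
  constructor
  · simpa using key 0 (by norm_num) Even.zero
  · simpa [mul_comm] using key 2 (by norm_num) even_two

theorem spherical_radial (hd : 1 < d) {η : ℝ → ℝ} (hη : ∀ ω, H ω = η ‖ω‖) {r : ℝ} (hr : 0 < r) :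
    firstSpherical H P Q r = sphereArea d / d * meanDiffSq P Q * η r ∧
    secondSpherical H P Q r = sphereArea d / (d * (d + 2)) * (3 *
        (2 * covDiffFrobSq P Q + (covDiff P Q).trace ^ 2 - meanDiffSq P Q ^ 2
          - 4 * skewMean P Q)) * η r := by
  have e : ∀ θ : Metric.sphere (0 : Euc d) 1, H (r • (θ : Euc d)) = η r := fun θ => by
    rw [hη, norm_smul, norm_eq_of_mem_sphere θ, Real.norm_of_nonneg hr.le, mul_one]
  constructor
  · simp only [firstSpherical, e]
    rw [integral_const_mul, integral_sphere_meanForm_sq P Q hd, mul_comm]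
  · simp only [secondSpherical, e]
    rw [integral_const_mul, integral_sphere_quartic_form P Q hd, mul_comm]

end Assumptions

/-! ### The expansion of the energy distance. -/

theorem proposition1 (d : ℕ) (hd : 1 < d) (H : Euc d → ℝ) (B : ℝ → ℝ) (b K : ℝ)
    (hb : b ∈ Set.Ioo (0 : ℝ) 1) :
    (∃ C : ℝ, 0 < C ∧
      ∀ (lam : ℝ), 0 < lam →
      ∀ (P Q : Measure (Euc d)) [IsProbabilityMeasure P] [IsProbabilityMeasure Q],
      MemLp (fun x : Euc d => x) 3 P → MemLp (fun x : Euc d => x) 3 Q →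
      ∀ (U V : Euc d → ℂ), LeadingMomentAssumptions H B b K lam P Q U V →
        (IntegrableOn (firstSpherical H P Q) (Set.Ioi 0) ∧
          IntegrableOn (fun r => r ^ 2 * secondSpherical H P Q r) (Set.Ioi 0) ∧
          |energyDistSq P Q
              - (1 / lam * (1 / energyConst d) * (∫ r in Set.Ioi (0 : ℝ), firstSpherical H P Q r)
                + 1 / lam ^ 3 * (1 / (12 * energyConst d)) *
                  (∫ r in Set.Ioi (0 : ℝ), r ^ 2 * secondSpherical H P Q r))|
            ≤ C * lam ^ (-(4 - b))) ∧
        (∀ h : ℝ → ℝ, (∀ ω, H ω = h ‖ω‖) →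
          IntegrableOn h (Set.Ioi 0) ∧ IntegrableOn (fun r => h r * r ^ 2) (Set.Ioi 0) ∧
          |energyDistSq P Q
              - (1 / lam * (sphereArea d / (energyConst d * d)) * meanDiffSq P Q *
                  (∫ r in Set.Ioi (0 : ℝ), h r)
                + 1 / lam ^ 3 * (sphereArea d / (4 * energyConst d * d * (d + 2))) *
                  (2 * covDiffFrobSq P Q + (covDiff P Q).trace ^ 2 - meanDiffSq P Q ^ 2
                    - 4 * skewMean P Q) *
                  (∫ r in Set.Ioi (0 : ℝ), h r * r ^ 2))|
            ≤ C * lam ^ (-(4 - b)))) ∧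
    (∀ (P : Measure (Euc d)) [IsProbabilityMeasure P],
      MemLp (fun x : Euc d => x) 3 P →
      P.map (fun x => WithLp.toLp 2 (fun i => 2 * mean P i - x i)) = P →
      ∀ i j, centralMoment₃ P i i j = 0) := by
  refine ⟨?_, fun P _ _ h i j => centralMoment₃_eq_zero_of_symmetric P h i i j⟩
  obtain ⟨C, hC, hbound⟩ := exists_remainder_bound hd B
  have hc := energyConst_pos d
  -- The absolute value and the summand `1` make the constant positive whatever the sign of `K`.
  refine ⟨1 / energyConst d * (C * |K|) + 1, by positivity, ?_⟩
  intro lam hlam P Q _ _ hP hQ U V h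
  obtain ⟨-, j1, j2, e⟩ := h.integral_leadingPart hd hlam
  have hR : |energyDistSq P Q
      - (1 / lam * (1 / energyConst d) * (∫ r in Set.Ioi (0 : ℝ), firstSpherical H P Q r)
        + 1 / lam ^ 3 * (1 / (12 * energyConst d)) *
          (∫ r in Set.Ioi (0 : ℝ), r ^ 2 * secondSpherical H P Q r))|
      ≤ (1 / energyConst d * (C * |K|) + 1) * lam ^ (-(4 - b)) := by
    have h1 := h.abs_remainder_le hd hlam hP hQ hC
      (hbound H b K lam P Q U V hP hQ h)
    have hp : 0 < lam ^ (-(4 - b)) := Real.rpow_pos_of_pos hlam _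
    rw [e] at h1
    refine le_trans (le_of_eq ?_) (h1.trans ?_)
    · congr 2
      field_simp
    · have : 1 / energyConst d * (C * (K * lam ^ (-(4 - b)))) ≤
          1 / energyConst d * (C * (|K| * lam ^ (-(4 - b)))) := by
        gcongr
        exact le_abs_self K
      linarith
  refine ⟨⟨j1, j2, hR⟩, fun η hη => ?_⟩
  obtain ⟨r1, r2⟩ := h.integrableOn_radial hd hlam hη
  refine ⟨r1, r2, ?_⟩
  -- For radial `H` the main terms are the same numbers rewritten, so the remainder is unchanged.
  refine le_trans (le_of_eq ?_) hR
  have f1 : ∫ r in Set.Ioi (0 : ℝ), firstSpherical H P Q r =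
      sphereArea d / d * meanDiffSq P Q * ∫ r in Set.Ioi (0 : ℝ), η r := by
    rw [← integral_const_mul]
    exact setIntegral_congr_fun measurableSet_Ioi fun r hr => (spherical_radial hd hη hr).1
  have f2 : ∫ r in Set.Ioi (0 : ℝ), r ^ 2 * secondSpherical H P Q r =
      sphereArea d / (d * (d + 2)) * (3 *
        (2 * covDiffFrobSq P Q + (covDiff P Q).trace ^ 2 - meanDiffSq P Q ^ 2
          - 4 * skewMean P Q)) * ∫ r in Set.Ioi (0 : ℝ), η r * r ^ 2 := by
    rw [← integral_const_mul]
    refine setIntegral_congr_fun measurableSet_Ioi fun r hr => ?_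
    simp only [(spherical_radial hd hη hr).2]
    ring
  have hd0 : (d : ℝ) ≠ 0 := by positivity
  rw [f1, f2]
  congr 2
  field_simp
  ring
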